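/- A centrally symmetric convex polygon is a set $A\subset\mathbb{R}^2$ with non-empty interior that is the convex hull of finitely many points and satisfies $-A=A$. Write $A^\circ=\{x\in\mathbb{R}^2:\langle a,x\rangle\le 1\text{ for all }a\in A\}$ for its polar and $M(A)=\operatorname{vol}(A)\operatorname{vol}(A^\circ)$ for its Mahler volume. The hyperplane presentation of $A$ is the least finite set $\mathcal{H}$ of lines not passing through the origin such that $A$ is the region bounded by $\mathcal{H}$, i.e. the intersection of the closed half-planes containing the origin that are bounded by the lines in $\mathcal{H}$. The vertex presentation of $A$ is the least finite set $\mathcal{P}$ of points whose convex hull is $A$. **Theorem.** Let $n>2$, and let $A\subset\mathbb{R}^2$ be a centrally symmetric convex polygon with $2n$ edges. Then $A$ has a hyperplane presentation $\mathcal{H}$ and a vertex presentation $\mathcal{P}$, and at least one of the following holds. 1. There is a line $H\in\mathcal{H}$ with $-H\in\mathcal{H}$ such that the region $A'$ bounded by $\mathcal{H}\setminus\{H,-H\}$ is a centrally symmetric convex polygon with $2(n-1)$ edges and $M(A')<M(A)$. 2. There is a point $x\in\mathcal{P}$ with $-x\in\mathcal{P}$ such that the convex hull $A'$ of $\mathcal{P}\setminus\{x,-x\}$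 is a centrally symmetric convex polygon with $2(n-1)$ edges and $M(A')<M(A)$. -/

import Mathlib

open MeasureTheory
open scoped Pointwise

/-- The Euclidean plane. -/
abbrev Plane : Type := EuclideanSpace ℝ (Fin 2)

/-- A centrally symmetric convex polygon: the convex hull of finitely many points, with
non-empty interior, invariant under `x ↦ -x`. -/
structure IsCentrallySymmetricPolygon (A : Set Plane) : Prop where
  exists_finite_hull : ∃ P : Set Plane, P.Finite ∧ A = convexHull ℝ P
  interior_nonempty : (interior A).Nonempty
  neg_eq : -A = A

/-- The edges of a convex polygon: its one-dimensional (exposed) faces. -/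
def polygonEdges (A : Set Plane) : Set (Set Plane) :=
  {s | IsExposed ℝ A s ∧ Module.finrank ℝ (vectorSpan ℝ s) = 1}

/-- The polar body `A°`. -/
def polarBody (A : Set Plane) : Set Plane :=
  {x | ∀ a ∈ A, inner ℝ a x ≤ 1}

/-- The Mahler volume `vol(A) vol(A°)`, for Lebesgue measure. -/
noncomputable def mahlerVolume (A : Set Plane) : ENNReal :=
  volume A * volume (polarBody A)

/-- The line `{x : ⟨x, u⟩ = c}`. -/
def lineOf (u : Plane) (c : ℝ) : Set Plane :=
  {x | inner ℝ x u = c}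

/-- A line in the plane that does not pass through the origin. Written in this way with
`‖u‖ = 1` and `c > 0`, the pair `(u, c)` is determined by the line. -/
def IsLineOffOrigin (H : Set Plane) : Prop :=
  ∃ (u : Plane) (c : ℝ), ‖u‖ = 1 ∧ 0 < c ∧ H = lineOf u c

/-- The region around the origin bounded by a set of lines that avoid the origin: the
intersection of the closed half-planes containing the origin that are bounded by those lines. -/
def boundedRegion (𝓗 : Set (Set Plane)) : Set Plane :=
  {x | ∀ (u : Plane) (c : ℝ), ‖u‖ = 1 → 0 < c → lineOf u c ∈ 𝓗 → inner ℝ x u ≤ c}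

/-- `𝓗` is the hyperplane presentation of `A`: the least (for inclusion) finite set of lines
bounding the region `A`. -/
def IsHyperplanePresentation (A : Set Plane) (𝓗 : Set (Set Plane)) : Prop :=
  IsLeast {𝓖 : Set (Set Plane) |
    𝓖.Finite ∧ (∀ H ∈ 𝓖, IsLineOffOrigin H) ∧ boundedRegion 𝓖 = A} 𝓗

/-- `𝓟` is the vertex presentation of `A`: the least (for inclusion) finite set of points
with convex hull `A`. -/
def IsVertexPresentation (A 𝓟 : Set Plane) : Prop :=
  IsLeast {𝓠 : Set Plane | 𝓠.Finite ∧ convexHull ℝ 𝓠 = A} 𝓟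

/-! Deleting opposite vertices `±x` of `A` cuts two opposite triangles off `A` and adds two to `A°`.
Deleting two opposite edges is the same operation with `A` and `A°` exchanged, since the edges of
`A` are dual to the vertices of `A°`; so only vertex deletion has to be computed (`VertexCap`).

Let `V`, `U` be the areas of `A`, `A°`, and let the two moves produce the products `(V - α)(U + β)`
and `(V + γ)(U - δ)`. If neither is less than `VU`, then eliminating `U` from the two inequalities
gives `V(γβ - αδ) ≥ αγ(β + δ) > 0`. So a vertex and an edge with `γβ ≤ αδ` suffice
(`mul_lt_or_mul_lt_of_mul_le`).

Take a vertex `x` and an edge `qx` at it, dual to `w₀`. Let `v` and `w₁` be dual to the next edges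
at `q` and at `x`, put `k = ⟨q, w₁⟩`, `l = ⟨x, v⟩`, and let `y = -a q + (1 + a k) x` be the other
neighbor of `x`. Then `γβ / (αδ) = (1 - k) / ((1 - k l)(1 + a k))`, where `k, l < 1` and `a > 0`,
and this is at most 1 once `k ≥ 0` (`IncidenceChain.mahlerVolume_lt`).

More than four vertices allow `k ≥ 0`. Given an edge `x₁x₂` dual to `w₁`, some vertex `u` other than
`±x₁, ±x₂` has `⟨u, w₁⟩ ≥ 0`, by symmetry. It lies beyond one end of the edge, and convexity forces
the next vertex at that end to be on the nonnegative side too (`exists_incidenceChain`). -/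

namespace Plane

/-! ### Linear algebra in the plane -/

open Filter Topology

/-- The determinant of two plane vectors. -/
def det (x y : Plane) : ℝ := x 0 * y 1 - x 1 * y 0

/-- Rotation by a quarter turn. -/
noncomputable def rot (x : Plane) : Plane := !₂[-x 1, x 0]

@[simp] theorem rot_zero (x : Plane) : rot x 0 = -x 1 := rfl
@[simp] theorem rot_one (x : Plane) : rot x 1 = x 0 := rfl

theorem inner_eq (x y : Plane) : inner ℝ x y = x 0 * y 0 + x 1 * y 1 := by
  simp [PiLp.inner_apply, Fin.sum_univ_two]; ring

theorem ext_coord {x y : Plane} (h0 : x 0 = y 0) (h1 : x 1 = y 1) : x = y := by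
  ext i; fin_cases i <;> assumption

theorem rot_ne_zero {x : Plane} (hx : x ≠ 0) : rot x ≠ 0 := by
  intro h
  apply hx
  have h0 := congrArg (fun z : Plane => z 0) h
  have h1 := congrArg (fun z : Plane => z 1) h
  simp at h0 h1
  exact ext_coord (by simpa using h1) (by simpa using h0)

theorem inner_rot (x : Plane) : inner ℝ x (rot x) = 0 := by
  rw [inner_eq]; simp; ring

theorem exists_smul_rot {x d : Plane} (hx : x ≠ 0) (h : inner ℝ x d = 0) :
    ∃ t : ℝ, d = t • rot x := by
  have hn : x 0 * x 0 + x 1 * x 1 ≠ 0 := by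
    rw [← inner_eq]; simpa using hx
  rw [inner_eq] at h
  refine ⟨(x 0 * d 1 - x 1 * d 0) / (x 0 * x 0 + x 1 * x 1), ext_coord ?_ ?_⟩
  · simp only [PiLp.smul_apply, rot_zero, smul_eq_mul]
    rw [div_mul_eq_mul_div, eq_div_iff hn]
    linear_combination (x 0) * h
  · simp only [PiLp.smul_apply, rot_one, smul_eq_mul]
    rw [div_mul_eq_mul_div, eq_div_iff hn]
    linear_combination (x 1) * h

/-- The determinants of two pairs in duality are related by the Gram determinant. -/
theorem det_mul_det (q x w w' : Plane) :
    det w w' * det q x = inner ℝ q w * inner ℝ x w' - inner ℝ x w * inner ℝ q w' := by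
  simp only [det, inner_eq]; ring

/-- A line missing the origin meets each line through the origin at most once. Hence the end points
of an edge can serve as a basis. -/
theorem det_ne_zero_of_inner_eq_one {x x' w : Plane} (hne : x ≠ x') (h : inner ℝ x w = 1)
    (h' : inner ℝ x' w = 1) : det x x' ≠ 0 := by
  intro hd
  rw [inner_eq] at h h'
  unfold det at hd
  apply hne
  refine ext_coord ?_ ?_
  · linear_combination (-x 0) * h' + (x' 0) * h + w 1 * hd
  · linear_combination (-x 1) * h' + (x' 1) * h - w 0 * hd

theorem eq_of_inner_eq {x x' w w' : Plane} (hd : det x x' ≠ 0) (h : inner ℝ x w = inner ℝ x w')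
    (h' : inner ℝ x' w = inner ℝ x' w') : w = w' := by
  rw [inner_eq, inner_eq] at h h'
  unfold det at hd
  refine ext_coord ?_ ?_
  · apply mul_left_cancel₀ hd
    linear_combination (x' 1) * h - x 1 * h'
  · apply mul_left_cancel₀ hd
    linear_combination (-x' 0) * h + x 0 * h'

/-- Two lines through two common points agree. -/
theorem eq_of_inner_eq_one {x x' w w' : Plane} (hne : x ≠ x') (h1 : inner ℝ x w = 1)
    (h2 : inner ℝ x' w = 1) (h3 : inner ℝ x w' = 1) (h4 : inner ℝ x' w' = 1) : w = w' :=
  eq_of_inner_eq (det_ne_zero_of_inner_eq_one hne h1 h2) (h1.trans h3.symm) (h2.trans h4.symm)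

theorem exists_inner_eq {x x' : Plane} (hd : det x x' ≠ 0) (s t : ℝ) :
    ∃ w : Plane, inner ℝ x w = s ∧ inner ℝ x' w = t := by
  refine ⟨!₂[(s * x' 1 - t * x 1) / det x x', (t * x 0 - s * x' 0) / det x x'], ?_, ?_⟩ <;>
  · rw [inner_eq]; simp; field_simp; simp only [det]; ring

theorem exists_eq_smul_add_smul {x x' : Plane} (hd : det x x' ≠ 0) (z : Plane) :
    ∃ s t : ℝ, z = s • x + t • x' := by
  refine ⟨det z x' / det x x', det x z / det x x', ext_coord ?_ ?_⟩ <;>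
  · simp; field_simp; simp only [det]; ring

/-! ### Polar bodies -/

theorem mem_polarBody {A : Set Plane} {w : Plane} :
    w ∈ polarBody A ↔ ∀ a ∈ A, inner ℝ a w ≤ 1 := Iff.rfl

theorem polarBody_eq_iInter (A : Set Plane) :
    polarBody A = ⋂ a ∈ A, {w | inner ℝ a w ≤ 1} := by
  ext; simp [polarBody]

theorem convex_inner_le (a : Plane) (c : ℝ) : Convex ℝ {w : Plane | inner ℝ a w ≤ c} :=
  convex_halfSpace_le (innerSL ℝ a).toLinearMap.isLinear c

theorem isClosed_inner_le (a : Plane) (c : ℝ) : IsClosed {w : Plane | inner ℝ a w ≤ c} :=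
  isClosed_le (by fun_prop) continuous_const

theorem convex_polarBody (A : Set Plane) : Convex ℝ (polarBody A) := by
  rw [polarBody_eq_iInter]
  exact convex_iInter₂ fun a _ => convex_inner_le a 1

theorem isClosed_polarBody (A : Set Plane) : IsClosed (polarBody A) := by
  rw [polarBody_eq_iInter]
  exact isClosed_biInter fun a _ => isClosed_inner_le a 1

theorem polarBody_anti {A B : Set Plane} (h : A ⊆ B) : polarBody B ⊆ polarBody A :=
  fun _ hw a ha => hw a (h ha)

theorem polarBody_convexHull (S : Set Plane) : polarBody (convexHull ℝ S) = polarBody S := by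
  apply (polarBody_anti (subset_convexHull ℝ S)).antisymm
  intro w hw
  have : convexHull ℝ S ⊆ {a | inner ℝ w a ≤ 1} :=
    convexHull_min (fun a ha => by rw [Set.mem_ofPred, real_inner_comm]; exact hw a ha)
      (convex_inner_le w 1)
  intro a ha
  rw [real_inner_comm]; exact this ha

theorem neg_polarBody {A : Set Plane} (h : -A = A) : -polarBody A = polarBody A := by
  have key : ∀ w ∈ polarBody A, -w ∈ polarBody A := by
    intro w hw a ha
    have : -a ∈ A := by rw [← h]; simpa using ha
    simpa using hw _ this
  ext w
  exact ⟨fun hw => by simpa using key _ hw, fun hw => key _ hw⟩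

theorem subset_polarBody_polarBody (A : Set Plane) : A ⊆ polarBody (polarBody A) :=
  fun a ha w hw => by rw [real_inner_comm]; exact hw a ha

/-- The bipolar theorem. -/
theorem polarBody_polarBody {A : Set Plane} (hc : Convex ℝ A) (hcl : IsClosed A)
    (h0 : (0 : Plane) ∈ A) : polarBody (polarBody A) = A := by
  refine Set.Subset.antisymm (fun z hz => ?_) (subset_polarBody_polarBody A)
  by_contra hzA
  obtain ⟨f, u, hf, hu⟩ := geometric_hahn_banach_closed_point hc hcl hzA
  have hu0 : 0 < u := by simpa using hf 0 h0
  set w : Plane := (InnerProductSpace.toDual ℝ Plane).symm f with hw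
  have hfw : ∀ a, inner ℝ w a = f a := fun a => by simp [hw]
  have hmem : u⁻¹ • w ∈ polarBody A := by
    intro a ha
    rw [real_inner_comm, real_inner_smul_left, hfw, inv_mul_le_iff₀ hu0]
    simpa using (hf a ha).le
  have := hz _ hmem
  rw [real_inner_smul_left, hfw, inv_mul_le_iff₀ hu0] at this
  linarith

theorem polarBody_mem_nhds {A : Set Plane} (h : Bornology.IsBounded A) :
    polarBody A ∈ 𝓝 (0 : Plane) := by
  obtain ⟨R, hR, hA⟩ := h.exists_pos_norm_le
  refine Filter.mem_of_superset (Metric.ball_mem_nhds 0 (inv_pos.2 hR)) fun w hw a ha => ?_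
  have hw' : ‖w‖ < R⁻¹ := by simpa using hw
  calc inner ℝ a w ≤ ‖a‖ * ‖w‖ := real_inner_le_norm a w
    _ ≤ R * R⁻¹ := mul_le_mul (hA a ha) hw'.le (norm_nonneg _) hR.le
    _ = 1 := mul_inv_cancel₀ hR.ne'

theorem isBounded_polarBody {A : Set Plane} (h : A ∈ 𝓝 (0 : Plane)) :
    Bornology.IsBounded (polarBody A) := by
  obtain ⟨r, hr, hA⟩ := Metric.mem_nhds_iff.1 h
  refine (Metric.isBounded_iff_subset_closedBall 0).2 ⟨2 / r, fun w hw => ?_⟩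
  rw [mem_closedBall_zero_iff]
  by_cases hw0 : w = 0
  · subst hw0; simp; positivity
  have hn : 0 < ‖w‖ := norm_pos_iff.2 hw0
  have hm : (r / 2 / ‖w‖) • w ∈ A := by
    apply hA
    rw [mem_ball_zero_iff, norm_smul, Real.norm_of_nonneg (by positivity)]
    field_simp
    linarith
  have := hw _ hm
  rw [real_inner_smul_left, real_inner_self_eq_norm_sq] at this
  rw [le_div_iff₀ hr]
  field_simp at this
  linarith

theorem isCompact_polarBody {A : Set Plane} (h : A ∈ 𝓝 (0 : Plane)) : IsCompact (polarBody A) :=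
  Metric.isCompact_of_isClosed_isBounded (isClosed_polarBody A) (isBounded_polarBody h)

/-! ### Extreme points -/

theorem neg_mem_extremePoints {A : Set Plane} (h : -A = A) {x : Plane}
    (hx : x ∈ A.extremePoints ℝ) : -x ∈ A.extremePoints ℝ := by
  have hneg : ∀ a ∈ A, -a ∈ A := fun a ha => by rw [← h]; simpa using ha
  rw [mem_extremePoints] at hx ⊢
  refine ⟨hneg _ hx.1, fun y hy z hz hyz => ?_⟩
  have := hx.2 (-y) (hneg _ hy) (-z) (hneg _ hz) ?_
  · exact ⟨by rw [← this.1, neg_neg], by rw [← this.2, neg_neg]⟩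
  · obtain ⟨a, b, ha, hb, hab, e⟩ := hyz
    refine ⟨a, b, ha, hb, hab, ?_⟩
    rw [smul_neg, smul_neg, ← neg_add, e, neg_neg]

/-- An extreme point that lies in the hull of some points of the set is one of them. -/
theorem mem_of_mem_convexHull {A S : Set Plane} (hA : Convex ℝ A) (hS : S ⊆ A) {u : Plane}
    (hu : u ∈ A.extremePoints ℝ) (h : u ∈ convexHull ℝ S) : u ∈ S :=
  extremePoints_convexHull_subset
    (inter_extremePoints_subset_extremePoints_of_subset (convexHull_min hS hA) ⟨h, hu⟩)

/-- A point of the polar that lies on two distinct supporting lines is extreme. -/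
theorem mem_extremePoints_polarBody {A : Set Plane} {x x' w : Plane} (hx : x ∈ A) (hx' : x' ∈ A)
    (hne : x ≠ x') (hw : w ∈ polarBody A) (h : inner ℝ x w = 1) (h' : inner ℝ x' w = 1) :
    w ∈ (polarBody A).extremePoints ℝ := by
  rw [mem_extremePoints_iff_left]
  refine ⟨hw, fun y hy z hz hyz => ?_⟩
  obtain ⟨a, b, ha, hb, hab, e⟩ := hyz
  have key : ∀ v ∈ A, inner ℝ v w = 1 → inner ℝ v y = 1 := by
    intro v hv hvw
    rw [← e, inner_add_right, real_inner_smul_right, real_inner_smul_right] at hvw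
    have h1 := hy v hv
    have h2 := hz v hv
    nlinarith
  exact eq_of_inner_eq_one hne (key x hx h) (key x' hx' h') h h'

/-- Points satisfying finitely many inequalities can be moved within the tight ones. -/
theorem exists_pos_perturb {P : Set Plane} (hP : P.Finite) {w d : Plane}
    (hw : w ∈ polarBody P) (hd : ∀ u ∈ P, inner ℝ u w = 1 → inner ℝ u d = 0) :
    ∃ ε : ℝ, 0 < ε ∧ w + ε • d ∈ polarBody P ∧ w - ε • d ∈ polarBody P := by
  have h1 : ∀ u ∈ P, ∀ᶠ ε in 𝓝 (0 : ℝ), inner ℝ u (w + ε • d) ≤ 1 := by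
    intro u hu
    rcases (hw u hu).eq_or_lt with h | h
    · refine Eventually.of_forall fun ε => ?_
      rw [inner_add_right, real_inner_smul_right, hd u hu h, h]; simp
    · have hc : ContinuousAt (fun ε : ℝ => inner ℝ u (w + ε • d)) 0 := by fun_prop
      have : ∀ᶠ ε in 𝓝 (0 : ℝ), inner ℝ u (w + ε • d) < 1 :=
        hc.eventually_lt continuousAt_const (by simpa using h)
      exact this.mono fun _ => le_of_lt
  have h2 : ∀ᶠ ε in 𝓝 (0 : ℝ), w + ε • d ∈ polarBody P := (eventually_all_finite hP).2 h1
  obtain ⟨r, hr, h3⟩ := Metric.eventually_nhds_iff.1 h2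
  refine ⟨r / 2, by positivity, h3 ?_, ?_⟩
  · simp [abs_of_pos hr, hr]
  · have := @h3 (-(r / 2)) (by simp [abs_of_pos hr, hr])
    simpa [sub_eq_add_neg] using this

theorem eq_zero_of_add_mem_of_sub_mem {K : Set Plane} {w e : Plane}
    (hw : w ∈ K.extremePoints ℝ) (h1 : w + e ∈ K) (h2 : w - e ∈ K) : e = 0 := by
  rw [mem_extremePoints_iff_left] at hw
  have := hw.2 _ h1 _ h2 ⟨1 / 2, 1 / 2, by norm_num, by norm_num, by norm_num, by module⟩
  simpa using this

theorem isCentrallySymmetricPolygon_of_finite {A P : Set Plane} (hP : P.Finite)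
    (hA : A = convexHull ℝ P) (hn : A ∈ 𝓝 (0 : Plane)) (hneg : -A = A) :
    IsCentrallySymmetricPolygon A :=
  ⟨⟨P, hP, hA⟩, ⟨0, mem_interior_iff_mem_nhds.2 hn⟩, hneg⟩

end Plane

/-! ### Duality between the vertices and edges of a polygon and of its polar -/

namespace IsCentrallySymmetricPolygon

open Filter Topology

open Plane

variable {A : Set Plane} (hA : IsCentrallySymmetricPolygon A)
include hA

theorem convex : Convex ℝ A := by
  obtain ⟨P, -, rfl⟩ := hA.exists_finite_hull
  exact convex_convexHull ℝ P

theorem isCompact : IsCompact A := by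
  obtain ⟨P, hP, rfl⟩ := hA.exists_finite_hull
  exact hP.isCompact_convexHull ℝ

theorem isClosed : IsClosed A := hA.isCompact.isClosed

theorem neg_mem {x : Plane} (hx : x ∈ A) : -x ∈ A := by
  rw [← hA.neg_eq]; simpa using hx

/-- The origin is the midpoint of an interior point and its mirror image, which is interior as well.
-/
theorem mem_nhds_zero : A ∈ 𝓝 (0 : Plane) := by
  obtain ⟨x, hx⟩ := hA.interior_nonempty
  have hneg : -x ∈ interior A := by
    have h : interior A ∈ 𝓝 (- -x) := by rw [neg_neg]; exact isOpen_interior.mem_nhds hx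
    have := (continuous_neg.tendsto (-x)).eventually h
    rw [mem_interior_iff_mem_nhds]
    filter_upwards [this] with z hz
    simpa using hA.neg_mem (interior_subset hz)
  have h0 : (0 : Plane) ∈ interior A := by
    have := hA.convex.interior hx hneg (a := 1 / 2) (b := 1 / 2) (by norm_num) (by norm_num)
      (by norm_num)
    simpa using this
  exact mem_interior_iff_mem_nhds.1 h0

theorem zero_mem : (0 : Plane) ∈ A := mem_of_mem_nhds hA.mem_nhds_zero

theorem finite_extremePoints : (A.extremePoints ℝ).Finite := by
  obtain ⟨P, hP, rfl⟩ := hA.exists_finite_hull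
  exact hP.subset extremePoints_convexHull_subset

theorem convexHull_extremePoints : convexHull ℝ (A.extremePoints ℝ) = A := by
  have := closure_convexHull_extremePoints hA.isCompact hA.convex
  rwa [(hA.finite_extremePoints.isClosed_convexHull ℝ).closure_eq] at this

theorem ne_zero {x : Plane} (hx : x ∈ A.extremePoints ℝ) : x ≠ 0 := by
  rintro rfl
  obtain ⟨a, ha, hne⟩ := (𝓝[≠] (0 : Plane)).nonempty_of_mem
    (inter_mem (mem_nhdsWithin_of_mem_nhds hA.mem_nhds_zero) self_mem_nhdsWithin)
  exact hne (eq_zero_of_add_mem_of_sub_mem hx (by simpa using ha)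
    (by simpa using hA.neg_mem ha))

theorem polarBody_polarBody : polarBody (polarBody A) = A :=
  Plane.polarBody_polarBody hA.convex hA.isClosed hA.zero_mem

theorem polarBody_extremePoints : polarBody (A.extremePoints ℝ) = polarBody A := by
  rw [← polarBody_convexHull, hA.convexHull_extremePoints]

/-- Each extreme point of the polar corresponds to a line through two vertices. -/
theorem exists_two_of_mem_extremePoints_polarBody {w : Plane}
    (hw : w ∈ (polarBody A).extremePoints ℝ) :
    ∃ x ∈ A.extremePoints ℝ, ∃ x' ∈ A.extremePoints ℝ, x ≠ x' ∧
      inner ℝ x w = 1 ∧ inner ℝ x' w = 1 := by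
  by_contra! h
  -- With at most one tight vertex there is a direction keeping all tight constraints tight, so `w`
  -- is the midpoint of a segment in the polar.
  obtain ⟨d, hd0, hd⟩ : ∃ d : Plane, d ≠ 0 ∧
      ∀ u ∈ A.extremePoints ℝ, inner ℝ u w = 1 → inner ℝ u d = 0 := by
    by_cases hx : ∃ x ∈ A.extremePoints ℝ, inner ℝ x w = 1
    · obtain ⟨x, hx, hxw⟩ := hx
      refine ⟨rot x, rot_ne_zero (hA.ne_zero hx), fun u hu huw => ?_⟩
      by_cases hux : x = u
      · rw [← hux, inner_rot]
      · exact absurd huw (h x hx u hu hux hxw)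
    · push Not at hx
      obtain ⟨d, hd⟩ := exists_ne (0 : Plane)
      exact ⟨d, hd, fun u hu huw => absurd huw (hx u hu)⟩
  have hw' : w ∈ polarBody (A.extremePoints ℝ) := by
    rw [hA.polarBody_extremePoints]; exact hw.1
  obtain ⟨ε, hε, h1, h2⟩ := exists_pos_perturb hA.finite_extremePoints hw' hd
  rw [hA.polarBody_extremePoints] at h1 h2
  have := eq_zero_of_add_mem_of_sub_mem hw h1 h2
  rcases smul_eq_zero.1 this with h | h
  · exact hε.ne' h
  · exact hd0 h

theorem finite_extremePoints_polarBody : ((polarBody A).extremePoints ℝ).Finite := by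
  have hP := hA.finite_extremePoints
  refine (hP.biUnion fun x _ => hP.biUnion fun x' _ =>
    Set.Subsingleton.finite (s := {w | x ≠ x' ∧ inner ℝ x w = 1 ∧ inner ℝ x' w = 1})
      fun w hw w' hw' => ?_).subset fun w hw => ?_
  · exact eq_of_inner_eq_one hw.1 hw.2.1 hw.2.2 hw'.2.1 hw'.2.2
  · obtain ⟨x, hx, x', hx', h⟩ := hA.exists_two_of_mem_extremePoints_polarBody hw
    simp only [Set.mem_iUnion]
    exact ⟨x, hx, x', hx', h⟩

theorem polar : IsCentrallySymmetricPolygon (polarBody A) := by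
  have hc := isCompact_polarBody hA.mem_nhds_zero
  have hf := hA.finite_extremePoints_polarBody
  refine isCentrallySymmetricPolygon_of_finite hf ?_
    (polarBody_mem_nhds hA.isCompact.isBounded) (neg_polarBody hA.neg_eq)
  have := closure_convexHull_extremePoints hc (convex_polarBody A)
  rwa [(hf.isClosed_convexHull ℝ).closure_eq, eq_comm] at this

/-- The points of the polar on the line dual to a vertex form a nondegenerate segment. -/
theorem exists_segment {x : Plane} (hx : x ∈ A.extremePoints ℝ) :
    ∃ w ∈ (polarBody A).extremePoints ℝ, ∃ w' ∈ (polarBody A).extremePoints ℝ,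
      w ≠ w' ∧ inner ℝ x w = 1 ∧ inner ℝ x w' = 1 ∧
      ∀ f ∈ polarBody A, inner ℝ x f = 1 → f ∈ segment ℝ w w' := by
  have hx0 := hA.ne_zero hx
  have hJ := rot_ne_zero hx0
  have hP := hA.finite_extremePoints
  have hxhull : x ∉ convexHull ℝ (A.extremePoints ℝ \ {x}) := fun h =>
    (mem_of_mem_convexHull hA.convex (Set.sdiff_subset.trans extremePoints_subset) hx h).2 rfl
  -- Separating `x` from the other vertices and rescaling gives a polar point `f` at which `x` alone
  -- is tight. It can therefore move both ways along the line dual to `x`.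
  obtain ⟨φ, u, hφ, hu⟩ := geometric_hahn_banach_closed_point (convex_convexHull ℝ _)
    ((hP.subset Set.sdiff_subset).isClosed_convexHull ℝ) hxhull
  have hlt : ∀ v ∈ A.extremePoints ℝ, v ≠ x → φ v < φ x := fun v hv hne =>
    (hφ v (subset_convexHull ℝ _ ⟨hv, hne⟩)).trans hu
  have hpos : 0 < φ x := by
    have := hlt (-x) (neg_mem_extremePoints hA.neg_eq hx) (fun h => hx0 (by
      have h2 : (2 : ℝ) • x = 0 := by rw [two_smul]; nth_rw 1 [← h]; simp
      simpa using h2))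
    rw [map_neg] at this
    linarith
  set f : Plane := (φ x)⁻¹ • (InnerProductSpace.toDual ℝ Plane).symm φ with hf
  have hfi : ∀ a, inner ℝ a f = φ a / φ x := fun a => by
    rw [hf, real_inner_smul_right, real_inner_comm, InnerProductSpace.toDual_symm_apply]
    field_simp
  have hxf : inner ℝ x f = 1 := by rw [hfi, div_self hpos.ne']
  have hfmem : f ∈ polarBody (A.extremePoints ℝ) := by
    intro v hv
    rw [hfi, div_le_one hpos]
    by_cases h : v = x
    · rw [h]
    · exact (hlt v hv h).le
  obtain ⟨ε, hε, h1, h2⟩ := exists_pos_perturb (d := rot x) hP hfmem fun v hv hvf => by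
    by_cases h : v = x
    · rw [h, inner_rot]
    · rw [hfi, div_eq_one_iff_eq hpos.ne'] at hvf
      exact absurd hvf (hlt v hv h).ne
  rw [hA.polarBody_extremePoints] at h1 h2 hfmem
  -- The trace of the polar on the line dual to `x`, parametrized from `f`: a compact interval,
  -- nondegenerate because it contains `±ε`.
  set T : Set ℝ := {t | f + t • rot x ∈ polarBody A} with hT
  have hTc : Convex ℝ T := by
    intro s hs t ht a b ha hb hab
    have := convex_polarBody A hs ht ha hb hab
    have e : a • (f + s • rot x) + b • (f + t • rot x) = f + (a • s + b • t) • rot x := by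
      have : f = (a + b) • f := by rw [hab, one_smul]
      rw [smul_eq_mul, smul_eq_mul]
      nth_rw 3 [this]
      module
    rwa [e] at this
  have hcl : IsClosed T := (isClosed_polarBody A).preimage (by fun_prop)
  obtain ⟨R, hR⟩ := (isBounded_polarBody hA.mem_nhds_zero).exists_norm_le
  have hTb : Bornology.IsBounded T := by
    refine (Metric.isBounded_iff_subset_closedBall 0).2 ⟨(R + ‖f‖) / ‖rot x‖, fun t ht => ?_⟩
    rw [mem_closedBall_zero_iff, le_div_iff₀ (norm_pos_iff.2 hJ), ← norm_smul]
    calc ‖t • rot x‖ = ‖(f + t • rot x) - f‖ := by congr 1; module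
      _ ≤ ‖f + t • rot x‖ + ‖f‖ := norm_sub_le _ _
      _ ≤ R + ‖f‖ := by gcongr; exact hR _ ht
  have hTcomp : IsCompact T := Metric.isCompact_of_isClosed_isBounded hcl hTb
  have hne : T.Nonempty := ⟨0, by simpa [hT] using hfmem⟩
  have hIcc := eq_Icc_of_connected_compact ⟨hne, hTc.isPreconnected⟩ hTcomp
  set a := sInf T
  set b := sSup T
  have hab : a < b := by
    have e1 : ε ∈ T := h1
    have e2 : -ε ∈ T := by simpa [hT, sub_eq_add_neg] using h2
    rw [hIcc] at e1 e2
    linarith [e1.2, e2.1]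
  have hline : ∀ g ∈ polarBody A, inner ℝ x g = 1 →
      ∃ t ∈ Set.Icc a b, g = f + t • rot x := by
    intro g hg hxg
    obtain ⟨t, ht⟩ := exists_smul_rot (d := g - f) hx0 (by rw [inner_sub_right, hxg, hxf, sub_self])
    have e : g = f + t • rot x := by rw [← ht]; abel
    refine ⟨t, ?_, e⟩
    rw [← hIcc]
    simpa [hT, ← e] using hg
  have hinner : ∀ t : ℝ, inner ℝ x (f + t • rot x) = 1 := fun t => by
    rw [inner_add_right, hxf, real_inner_smul_right, inner_rot]; simp
  have hinj : ∀ s t : ℝ, f + s • rot x = f + t • rot x → s = t := fun s t h =>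
    smul_left_injective ℝ hJ (add_left_cancel h)
  have hext : ∀ c ∈ ({a, b} : Set ℝ), f + c • rot x ∈ (polarBody A).extremePoints ℝ := by
    intro c hc
    have hcT : c ∈ T := by
      rw [hIcc]
      rcases hc with rfl | rfl
      · exact Set.left_mem_Icc.2 hab.le
      · exact Set.right_mem_Icc.2 hab.le
    rw [mem_extremePoints_iff_left]
    refine ⟨hcT, fun y hy z hz hyz => ?_⟩
    obtain ⟨α, β, hα, hβ, hαβ, e⟩ := hyz
    have hxe : α * inner ℝ x y + β * inner ℝ x z = 1 := by
      rw [← real_inner_smul_right, ← real_inner_smul_right, ← inner_add_right, e, hinner]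
    have hxy := hy x hx.1
    have hxz := hz x hx.1
    obtain ⟨s, hs, rfl⟩ := hline y hy (by nlinarith)
    obtain ⟨t, ht, rfl⟩ := hline z hz (by nlinarith)
    have e' : α * s + β * t = c := by
      apply hinj
      rw [← e]
      have : f = (α + β) • f := by rw [hαβ, one_smul]
      nth_rw 1 [this]
      module
    suffices hsc : s = c by rw [hsc]
    obtain ⟨hs1, hs2⟩ := hs
    obtain ⟨ht1, ht2⟩ := ht
    have hz : α * (s - c) + β * (t - c) = 0 := by linear_combination e' - c * hαβ
    -- As `c` is an end of the interval, both summands in `hz` have the same sign, so both vanish.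
    have hs0 : α * (s - c) = 0 := by
      rcases hc with rfl | rfl
      · linarith [mul_nonneg hα.le (sub_nonneg.2 hs1), mul_nonneg hβ.le (sub_nonneg.2 ht1)]
      · linarith [mul_nonneg hα.le (sub_nonneg.2 hs2), mul_nonneg hβ.le (sub_nonneg.2 ht2)]
    exact sub_eq_zero.1 ((mul_eq_zero.1 hs0).resolve_left hα.ne')
  refine ⟨_, hext a (by simp), _, hext b (by simp), fun h => hab.ne (hinj _ _ h), hinner a,
    hinner b, fun g hg hxg => ?_⟩
  obtain ⟨t, ht, rfl⟩ := hline g hg hxg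
  rw [segment_eq_image_lineMap]
  refine ⟨(t - a) / (b - a), ⟨div_nonneg (by linarith [ht.1]) (by linarith),
    (div_le_one (by linarith)).2 (by linarith [ht.2])⟩, ?_⟩
  rw [AffineMap.lineMap_apply_module']
  have hne : b - a ≠ 0 := by linarith
  have : (t - a) / (b - a) * (b - a) = t - a := div_mul_cancel₀ _ hne
  calc _ = f + ((t - a) / (b - a) * (b - a) + a) • rot x := by module
    _ = _ := by rw [this]; congr 2; ring

/-- Each vertex lies on exactly two lines dual to vertices of the polar. -/
theorem exists_pair {x : Plane} (hx : x ∈ A.extremePoints ℝ) :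
    ∃ w w' : Plane, w ≠ w' ∧
      {f ∈ (polarBody A).extremePoints ℝ | inner ℝ x f = 1} = {w, w'} := by
  obtain ⟨w, hw, w', hw', hne, h1, h2, h⟩ := hA.exists_segment hx
  refine ⟨w, w', hne, Set.Subset.antisymm (fun f hf => ?_) ?_⟩
  · have := h f hf.1.1 hf.2
    rw [← convexHull_pair] at this
    exact mem_of_mem_convexHull hA.polar.convex
      (Set.insert_subset hw.1 (Set.singleton_subset_iff.2 hw'.1)) hf.1 this
  · rintro f (rfl | rfl)
    · exact ⟨hw, h1⟩
    · exact ⟨hw', h2⟩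

/-- Each vertex of the polar is dual to a line through exactly two vertices. -/
theorem exists_pair_dual {w : Plane} (hw : w ∈ (polarBody A).extremePoints ℝ) :
    ∃ x x' : Plane, x ≠ x' ∧
      {u ∈ A.extremePoints ℝ | inner ℝ u w = 1} = {x, x'} := by
  have := hA.polar.exists_pair hw
  rw [hA.polarBody_polarBody] at this
  simpa only [real_inner_comm w] using this

/-- A polygon and its polar have the same number of vertices. -/
theorem ncard_extremePoints_polarBody :
    ((polarBody A).extremePoints ℝ).ncard = (A.extremePoints ℝ).ncard := by
  classical
  have hP := hA.finite_extremePoints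
  have hW := hA.finite_extremePoints_polarBody
  rw [Set.ncard_eq_toFinset_card _ hP, Set.ncard_eq_toFinset_card _ hW]
  -- Double counting of incidences: two on either side.
  have := Finset.card_mul_eq_card_mul (s := hW.toFinset) (t := hP.toFinset)
    (fun w x : Plane => inner ℝ x w = 1) (m := 2) (n := 2) ?_ ?_
  · omega
  · intro w hw
    obtain ⟨x, x', hne, h⟩ := hA.exists_pair_dual (hW.mem_toFinset.1 hw)
    refine Eq.trans ?_ (Finset.card_pair hne)
    congr 1
    ext u
    simpa [Finset.mem_bipartiteAbove] using Set.ext_iff.1 h u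
  · intro x hx
    obtain ⟨w, w', hne, h⟩ := hA.exists_pair (hP.mem_toFinset.1 hx)
    refine Eq.trans ?_ (Finset.card_pair hne)
    congr 1
    ext u
    simpa [Finset.mem_bipartiteBelow] using Set.ext_iff.1 h u

/-- The edges of a polygon correspond to the vertices of its polar. -/
theorem ncard_polygonEdges :
    (polygonEdges A).ncard = ((polarBody A).extremePoints ℝ).ncard := by
  symm
  have htwo : ∀ s : Set Plane, Module.finrank ℝ (vectorSpan ℝ s) = 1 →
      ∃ x ∈ s, ∃ x' ∈ s, x ≠ x' := by
    intro s hs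
    by_contra! h
    have : s.Subsingleton := fun x hx y hy => h x hx y hy
    rw [vectorSpan_of_subsingleton ℝ this] at hs
    simp at hs
  have hface : ∀ w ∈ (polarBody A).extremePoints ℝ,
      {x ∈ A | inner ℝ x w = 1} ∈ polygonEdges A := by
    intro w hw
    obtain ⟨x, hx, x', hx', hne, h, h'⟩ := hA.exists_two_of_mem_extremePoints_polarBody hw
    refine ⟨fun _ => ⟨innerSL ℝ w, ?_⟩, ?_⟩
    · ext y
      simp only [innerSL_apply_apply]
      constructor
      · rintro ⟨hy, hyw⟩
        refine ⟨hy, fun z hz => ?_⟩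
        rw [real_inner_comm, real_inner_comm y, hyw]
        exact hw.1 z hz
      · rintro ⟨hy, hmax⟩
        refine ⟨hy, (hw.1 y hy).antisymm ?_⟩
        have := hmax x hx.1
        rwa [real_inner_comm, h, real_inner_comm] at this
    · have hw0 : w ≠ 0 := hA.polar.ne_zero hw
      have hle : vectorSpan ℝ {x ∈ A | inner ℝ x w = 1} ≤ ℝ ∙ rot w := by
        rw [vectorSpan_def, Submodule.span_le]
        rintro _ ⟨y, hy, z, hz, rfl⟩
        obtain ⟨t, ht⟩ := exists_smul_rot (d := y - z) hw0 (by
          rw [inner_sub_right, real_inner_comm, hy.2, real_inner_comm, hz.2, sub_self])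
        exact Submodule.mem_span_singleton.2 ⟨t, by simpa using ht.symm⟩
      have h1 := Submodule.finrank_mono hle
      rw [finrank_span_singleton (rot_ne_zero hw0)] at h1
      refine le_antisymm h1 ?_
      rw [Nat.one_le_iff_ne_zero, Ne, Submodule.finrank_eq_zero]
      intro hbot
      have hmem := vsub_mem_vectorSpan ℝ (s := {x ∈ A | inner ℝ x w = 1})
        ⟨hx.1, h⟩ ⟨hx'.1, h'⟩
      rw [hbot, Submodule.mem_bot, vsub_eq_sub, sub_eq_zero] at hmem
      exact hne hmem
  refine Set.ncard_congr (fun w _ => {x ∈ A | inner ℝ x w = 1}) hface ?_ ?_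
  · intro w w' hw hw' heq
    obtain ⟨x, hx, x', hx', hne⟩ := htwo _ (hface w hw).2
    have e1 : x ∈ {x ∈ A | inner ℝ x w' = 1} := by rw [← heq]; exact hx
    have e2 : x' ∈ {x ∈ A | inner ℝ x w' = 1} := by rw [← heq]; exact hx'
    exact eq_of_inner_eq_one hne hx.2 hx'.2 e1.2 e2.2
  · rintro s ⟨hs, hdim⟩
    obtain ⟨x, hx, x', hx', hne⟩ := htwo s hdim
    obtain ⟨l, hl⟩ := hs ⟨x, hx⟩
    have hmax : ∀ y ∈ A, l y ≤ l x := by rw [hl] at hx; exact hx.2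
    have hxA : x ∈ A := by rw [hl] at hx; exact hx.1
    have hxA' : x' ∈ A := by rw [hl] at hx'; exact hx'.1
    have hseq : ∀ y, y ∈ s ↔ y ∈ A ∧ l y = l x := by
      intro y
      rw [hl]
      exact ⟨fun hy => ⟨hy.1, (hmax y hy.1).antisymm (hy.2 x hxA)⟩,
        fun hy => ⟨hy.1, fun z hz => hy.2 ▸ hmax z hz⟩⟩
    -- If the maximum were zero, `l` would be constant on `A` by symmetry, and the face would be `A`
    -- itself, of dimension two.
    have hpos : 0 < l x := by
      refine lt_of_le_of_ne (by simpa using hmax 0 hA.zero_mem) fun h0 => ?_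
      have hall : ∀ y ∈ A, l y = l x := fun y hy => by
        have h1 := hmax y hy
        have h2 := hmax (-y) (hA.neg_mem hy)
        rw [map_neg] at h2
        linarith
      have hsA : s = A := by
        ext y
        rw [hseq]
        exact ⟨fun h => h.1, fun h => ⟨h, hall y h⟩⟩
      have htop : vectorSpan ℝ s = ⊤ := by
        rw [hsA, ← direction_affineSpan,
          hA.convex.interior_nonempty_iff_affineSpan_eq_top.1 hA.interior_nonempty,
          AffineSubspace.direction_top]
      rw [htop] at hdim
      simp at hdim
    have hinner : ∀ y : Plane,
        inner ℝ y ((l x)⁻¹ • (InnerProductSpace.toDual ℝ Plane).symm l) = l y / l x := fun y => by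
      rw [real_inner_smul_right, real_inner_comm, InnerProductSpace.toDual_symm_apply]
      field_simp
    refine ⟨(l x)⁻¹ • (InnerProductSpace.toDual ℝ Plane).symm l, ?_, ?_⟩
    · refine mem_extremePoints_polarBody hxA hxA' hne (fun y hy => ?_) ?_ ?_
      · rw [hinner, div_le_one hpos]; exact hmax y hy
      · rw [hinner, div_self hpos.ne']
      · rw [hinner, ((hseq x').1 hx').2, div_self hpos.ne']
    · ext y
      rw [hseq]
      simp only [Set.mem_ofPred_eq, hinner, div_eq_one_iff_eq hpos.ne']

end IsCentrallySymmetricPolygon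

/-! ### Dual lines and the two presentations -/

namespace Plane

open Filter Topology

/-- The line `{x : ⟨x, w⟩ = 1}` dual to a point `w`. -/
def dualLine (w : Plane) : Set Plane := lineOf w 1

theorem lineOf_eq_dualLine (u : Plane) {c : ℝ} (hc : 0 < c) : lineOf u c = dualLine (c⁻¹ • u) := by
  ext x
  change inner ℝ x u = c ↔ inner ℝ x (c⁻¹ • u) = 1
  rw [real_inner_smul_right, inv_mul_eq_one₀ hc.ne', eq_comm]

theorem isLineOffOrigin_dualLine {w : Plane} (hw : w ≠ 0) : IsLineOffOrigin (dualLine w) := by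
  have hn : 0 < ‖w‖ := norm_pos_iff.2 hw
  refine ⟨‖w‖⁻¹ • w, ‖w‖⁻¹, norm_smul_inv_norm hw, inv_pos.2 hn, ?_⟩
  rw [lineOf_eq_dualLine _ (inv_pos.2 hn), smul_smul, inv_inv, mul_inv_cancel₀ hn.ne', one_smul]

theorem exists_eq_dualLine {H : Set Plane} (h : IsLineOffOrigin H) :
    ∃ w : Plane, w ≠ 0 ∧ H = dualLine w := by
  obtain ⟨u, c, hu, hc, rfl⟩ := h
  refine ⟨c⁻¹ • u, smul_ne_zero (inv_ne_zero hc.ne') ?_, lineOf_eq_dualLine u hc⟩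
  rintro rfl
  simp at hu

theorem dualLine_injOn : Set.InjOn dualLine {w : Plane | w ≠ 0} := by
  intro w hw w' _ h
  have hn : inner ℝ w w ≠ 0 := inner_self_ne_zero.2 hw
  have h1 : inner ℝ ((inner ℝ w w : ℝ)⁻¹ • w) w = 1 := by
    rw [real_inner_smul_left, inv_mul_cancel₀ hn]
  have h2 : inner ℝ ((inner ℝ w w : ℝ)⁻¹ • w + rot w) w = 1 := by
    rw [inner_add_left, h1, real_inner_comm, inner_rot, add_zero]
  have e1 : (inner ℝ w w : ℝ)⁻¹ • w ∈ dualLine w' := by rw [← h]; exact h1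
  have e2 : (inner ℝ w w : ℝ)⁻¹ • w + rot w ∈ dualLine w' := by rw [← h]; exact h2
  exact eq_of_inner_eq_one (by simpa using (rot_ne_zero hw)) h1 h2 e1 e2

theorem neg_dualLine (w : Plane) : -dualLine w = dualLine (-w) := by
  ext x
  change inner ℝ (-x) w = 1 ↔ inner ℝ x (-w) = 1
  rw [inner_neg_left, inner_neg_right]

theorem boundedRegion_image_dualLine {S : Set Plane} (hS : ∀ w ∈ S, w ≠ 0) :
    boundedRegion (dualLine '' S) = polarBody S := by
  ext x
  constructor
  · intro hx w hw
    have hn : 0 < ‖w‖ := norm_pos_iff.2 (hS w hw)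
    have hmem : lineOf (‖w‖⁻¹ • w) ‖w‖⁻¹ ∈ dualLine '' S := by
      refine ⟨w, hw, ?_⟩
      rw [lineOf_eq_dualLine _ (inv_pos.2 hn), smul_smul, inv_inv, mul_inv_cancel₀ hn.ne',
        one_smul]
    have := hx _ _ (norm_smul_inv_norm (hS w hw)) (inv_pos.2 hn) hmem
    rw [real_inner_smul_right] at this
    rw [real_inner_comm]
    exact (mul_le_iff_le_one_right (inv_pos.2 hn)).1 this
  · rintro hx u c hu hc ⟨w, hw, h⟩
    rw [lineOf_eq_dualLine u hc] at h
    have hu0 : u ≠ 0 := by rintro rfl; simp at hu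
    obtain rfl := dualLine_injOn (hS w hw) (smul_ne_zero (inv_ne_zero hc.ne') hu0) h
    have := hx _ hw
    rwa [real_inner_smul_left, inv_mul_le_iff₀ hc, mul_one, real_inner_comm] at this

theorem isVertexPresentation {A : Set Plane} (hA : IsCentrallySymmetricPolygon A) :
    IsVertexPresentation A (A.extremePoints ℝ) := by
  refine ⟨⟨hA.finite_extremePoints, hA.convexHull_extremePoints⟩, ?_⟩
  rintro Q ⟨-, rfl⟩
  exact extremePoints_convexHull_subset

/-- Leastness comes from the bipolar theorem. A finite family bounding `A` is dual to a finite `S`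
with polar `A`. Adjoining 0 does not change this polar, so `A°` is the hull of `S` and 0; its
vertices are nonzero and so belong to `S`. -/
theorem isHyperplanePresentation {A : Set Plane} (hA : IsCentrallySymmetricPolygon A) :
    IsHyperplanePresentation A (dualLine '' (polarBody A).extremePoints ℝ) := by
  have hne : ∀ w ∈ (polarBody A).extremePoints ℝ, w ≠ 0 := fun w hw => hA.polar.ne_zero hw
  refine ⟨⟨hA.polar.finite_extremePoints.image _, ?_, ?_⟩, ?_⟩
  · rintro _ ⟨w, hw, rfl⟩
    exact isLineOffOrigin_dualLine (hne w hw)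
  · rw [boundedRegion_image_dualLine hne, hA.polar.polarBody_extremePoints,
      hA.polarBody_polarBody]
  · rintro G ⟨hG, hline, hreg⟩
    set S : Set Plane := {w | w ≠ 0 ∧ dualLine w ∈ G} with hSdef
    have hGS : G = dualLine '' S := by
      ext H
      constructor
      · intro hH
        obtain ⟨w, hw, rfl⟩ := exists_eq_dualLine (hline H hH)
        exact ⟨w, ⟨hw, hH⟩, rfl⟩
      · rintro ⟨w, hw, rfl⟩
        exact hw.2
    have hSfin : S.Finite :=
      Set.Finite.of_finite_image (hGS ▸ hG) (dualLine_injOn.mono fun w hw => hw.1)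
    rw [hGS, boundedRegion_image_dualLine fun w hw => hw.1] at hreg
    have h0 : polarBody (insert 0 S) = A := by
      rw [← hreg]
      ext w
      simp [mem_polarBody]
    have hpol : polarBody A = convexHull ℝ (insert 0 S) := by
      rw [← h0, ← polarBody_convexHull (insert 0 S)]
      exact polarBody_polarBody (convex_convexHull ℝ _) ((hSfin.insert 0).isClosed_convexHull ℝ)
        (subset_convexHull ℝ _ (Set.mem_insert 0 S))
    rw [hGS]
    refine Set.image_mono fun w hw => ?_
    have hw' := hw
    rw [hpol] at hw'
    exact (extremePoints_convexHull_subset hw').resolve_left (hne w hw)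

/-- Removing a pair of opposite lines amounts to removing a pair of opposite dual points. -/
theorem boundedRegion_image_dualLine_sdiff {S : Set Plane} (hS : ∀ w ∈ S, w ≠ 0) {w : Plane}
    (hw : w ∈ S) (hw' : -w ∈ S) :
    boundedRegion (dualLine '' S \ {dualLine w, -dualLine w}) = polarBody (S \ {w, -w}) := by
  have hinj : Set.InjOn dualLine S := dualLine_injOn.mono hS
  rw [← boundedRegion_image_dualLine fun v hv => hS v hv.1, neg_dualLine, ← Set.image_pair,
    hinj.image_sdiff_subset (Set.pair_subset hw hw')]

/-! ### Areas of triangles and of opposite caps -/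

theorem volume_dualLine {w : Plane} (hw : w ≠ 0) : volume {z : Plane | inner ℝ w z = 1} = 0 := by
  have hn : inner ℝ w w ≠ 0 := inner_self_ne_zero.2 hw
  have hp : inner ℝ w ((inner ℝ w w : ℝ)⁻¹ • w) = 1 := by
    rw [real_inner_smul_right, inv_mul_cancel₀ hn]
  refine measure_mono_null (t := (AffineSubspace.mk' ((inner ℝ w w : ℝ)⁻¹ • w)
    (LinearMap.ker (innerSL ℝ w).toLinearMap) : Set Plane)) (fun z hz => ?_)
    (Measure.addHaar_affineSubspace _ _ fun h => ?_)
  · rw [SetLike.mem_coe, AffineSubspace.mem_mk', LinearMap.mem_ker]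
    change inner ℝ w (z - _) = 0
    have hz' : inner ℝ w z = 1 := hz
    rw [inner_sub_right, hp, hz', sub_self]
  · have := congrArg AffineSubspace.direction h
    rw [AffineSubspace.direction_mk', AffineSubspace.direction_top] at this
    have hmem : w ∈ LinearMap.ker (innerSL ℝ w).toLinearMap := by rw [this]; trivial
    exact hn (LinearMap.mem_ker.1 hmem)

theorem smul_add_smul_mem_convexHull {p q r : Plane} {s t : ℝ} (hs : 0 ≤ s) (ht : 0 ≤ t)
    (hst : s + t ≤ 1) : p + s • (q - p) + t • (r - p) ∈ convexHull ℝ {p, q, r} := by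
  have hc := convex_convexHull ℝ ({p, q, r} : Set Plane)
  have hsub := subset_convexHull ℝ ({p, q, r} : Set Plane)
  have := hc.sum_mem (t := Finset.univ) (w := ![1 - s - t, s, t]) (z := ![p, q, r])
    (by simp [Fin.forall_fin_succ]; exact ⟨by linarith, hs, ht⟩)
    (by simp [Fin.sum_univ_succ])
    (by simp [Fin.forall_fin_succ]; exact ⟨hsub (by simp), hsub (by simp), hsub (by simp)⟩)
  convert this using 1
  simp [Fin.sum_univ_succ]
  module

/-- Twice the area of a triangle with a vertex at the origin. -/
theorem volume_convexHull_zero {u v : Plane} (hd : det u v ≠ 0) :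
    volume (convexHull ℝ {0, u, v}) + volume (convexHull ℝ {0, u, v}) =
      ENNReal.ofReal |det u v| := by
  -- The dual basis of `u, v`: pairing with `f` and `g` reads off coordinates.
  obtain ⟨f, hfu, hfv⟩ := exists_inner_eq hd 1 0
  obtain ⟨g, hgu, hgv⟩ := exists_inner_eq hd 0 1
  have hz : ∀ z : Plane, z = inner ℝ z f • u + inner ℝ z g • v := fun z => by
    obtain ⟨s, t, rfl⟩ := exists_eq_smul_add_smul hd z
    simp only [inner_add_left, real_inner_smul_left, hfu, hfv, hgu, hgv]
    module
  set T := convexHull ℝ ({0, u, v} : Set Plane) with hT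
  have hTmem : ∀ z, z ∈ T ↔ 0 ≤ inner ℝ z f ∧ 0 ≤ inner ℝ z g ∧ inner ℝ z f + inner ℝ z g ≤ 1 := by
    intro z
    constructor
    · have hc : Convex ℝ {z : Plane | 0 ≤ inner ℝ z f ∧ 0 ≤ inner ℝ z g ∧
          inner ℝ z f + inner ℝ z g ≤ 1} := by
        intro x hx y hy a b ha hb hab
        simp only [Set.mem_ofPred_eq, inner_add_left, real_inner_smul_left] at hx hy ⊢
        obtain ⟨h1, h2, h3⟩ := hx
        obtain ⟨h4, h5, h6⟩ := hy
        refine ⟨by positivity, by positivity, ?_⟩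
        nlinarith [mul_le_mul_of_nonneg_left h3 ha, mul_le_mul_of_nonneg_left h6 hb]
      have hsub : T ⊆ _ := convexHull_min (by
        rintro z (rfl | rfl | rfl)
        · simp
        · simp [hfu, hgu]
        · simp [hfv, hgv]) hc
      exact fun h => hsub h
    · rintro ⟨h1, h2, h3⟩
      have := smul_add_smul_mem_convexHull (p := 0) (q := u) (r := v) h1 h2 h3
      rw [hz z]
      simpa using this
  have hTm : MeasurableSet T :=
    (((Set.finite_singleton v).insert u).insert 0 |>.isClosed_convexHull ℝ).measurableSet
  have hTv : volume ((fun z => (u + v) - z) ⁻¹' T) = volume T :=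
    (Measure.measurePreserving_sub_left volume (u + v)).measure_preimage hTm.nullMeasurableSet
  -- The triangle and its reflection in the center tile the parallelogram, overlapping only on the
  -- diagonal `uv`.
  have hQ : parallelepiped ![u, v] = T ∪ (fun z => (u + v) - z) ⁻¹' T := by
    ext z
    have e1 : inner ℝ (u + v - z) f = 1 - inner ℝ z f := by
      rw [inner_sub_left, inner_add_left, hfu, hfv, add_zero]
    have e2 : inner ℝ (u + v - z) g = 1 - inner ℝ z g := by
      rw [inner_sub_left, inner_add_left, hgu, hgv, zero_add]
    rw [Set.mem_union, Set.mem_preimage, hTmem, hTmem, e1, e2, mem_parallelepiped_iff]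
    constructor
    · rintro ⟨t, ⟨ht0, ht1⟩, rfl⟩
      have a0 := ht0 0
      have a1 := ht0 1
      have b0 := ht1 0
      have b1 := ht1 1
      simp only [Pi.zero_apply, Pi.one_apply] at a0 a1 b0 b1
      simp only [Fin.sum_univ_two, Matrix.cons_val_zero, Matrix.cons_val_one, inner_add_left,
        real_inner_smul_left, hfu, hfv, hgu, hgv]
      rcases le_total (t 0 + t 1) 1 with h | h
      · left; refine ⟨?_, ?_, ?_⟩ <;> linarith
      · right; refine ⟨?_, ?_, ?_⟩ <;> linarith
    · intro h
      refine ⟨![inner ℝ z f, inner ℝ z g], ⟨?_, ?_⟩, by simpa [Fin.sum_univ_two] using hz z⟩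
      · intro i
        rcases h with h | h <;> fin_cases i <;> simp <;> linarith
      · intro i
        rcases h with h | h <;> fin_cases i <;> simp <;> linarith
  have hfg : f + g ≠ 0 := by
    intro h
    have : inner ℝ u (f + g) = 1 := by rw [inner_add_right, hfu, hgu, add_zero]
    rw [h, inner_zero_right] at this
    exact zero_ne_one this
  have hdisj : AEDisjoint volume T ((fun z => (u + v) - z) ⁻¹' T) := by
    refine measure_mono_null (fun z hz => ?_) (volume_dualLine hfg)
    obtain ⟨h1, h2⟩ := hz
    rw [Set.mem_preimage, hTmem] at h2
    rw [hTmem] at h1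
    have e1 : inner ℝ (u + v - z) f = 1 - inner ℝ z f := by
      rw [inner_sub_left, inner_add_left, hfu, hfv, add_zero]
    have e2 : inner ℝ (u + v - z) g = 1 - inner ℝ z g := by
      rw [inner_sub_left, inner_add_left, hgu, hgv, zero_add]
    rw [e1, e2] at h2
    change inner ℝ (f + g) z = 1
    rw [real_inner_comm, inner_add_right]
    linarith [h1.2.2, h2.2.2]
  have hvol : volume (parallelepiped ![u, v]) = ENNReal.ofReal |det u v| := by
    rw [← (EuclideanSpace.basisFun (Fin 2) ℝ).addHaar_eq_volume, Measure.addHaar_parallelepiped,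
      Module.Basis.det_apply, Matrix.det_fin_two]
    simp [Module.Basis.toMatrix_apply, det]
    congr 2
    ring
  rw [← hvol, hQ, measure_union₀ (hTm.preimage (by fun_prop)).nullMeasurableSet hdisj, hTv]

/-- Twice the area of a triangle. -/
theorem volume_convexHull_triple {p q r : Plane} (hd : det (q - p) (r - p) ≠ 0) :
    volume (convexHull ℝ {p, q, r}) + volume (convexHull ℝ {p, q, r}) =
      ENNReal.ofReal |det (q - p) (r - p)| := by
  have : convexHull ℝ {p, q, r} = p +ᵥ convexHull ℝ {0, q - p, r - p} := by
    rw [← convexHull_vadd]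
    congr 1
    simp [← Set.image_vadd, Set.image_insert_eq]
  rw [this, measure_vadd, volume_convexHull_zero hd]

theorem det_sub_ne_zero {b p q r : Plane} (hne : q ≠ p) (hpb : inner ℝ p b = 1)
    (hqb : inner ℝ q b = 1) (hrb : inner ℝ r b ≠ 1) : det (q - p) (r - p) ≠ 0 := by
  intro h
  have hi : ∀ x y : Plane, inner ℝ (x - y) b = inner ℝ x b - inner ℝ y b := fun x y =>
    inner_sub_left x y b
  have h1 : inner ℝ (q - p) b = 0 := by rw [hi, hqb, hpb, sub_self]
  have h2 : inner ℝ (r - p) b ≠ 0 := by rw [hi, hpb]; exact sub_ne_zero.2 hrb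
  have h3 : q - p ≠ 0 := sub_ne_zero.2 hne
  rw [inner_eq] at h1 h2
  unfold det at h
  apply h3
  refine ext_coord ((mul_eq_zero.1 ?_).resolve_right h2) ((mul_eq_zero.1 ?_).resolve_right h2)
  · linear_combination ((r - p) 0) * h1 + b 1 * h
  · linear_combination ((r - p) 1) * h1 - b 0 * h

/-- A triangle contains the intersection of the three half-planes bounded by its sides. -/
theorem mem_convexHull_of_le {a b c p q r z : Plane}
    (hpa : 1 < inner ℝ p a) (hpb : inner ℝ p b = 1) (hpc : inner ℝ p c = 1)
    (hqa : inner ℝ q a = 1) (hqb : inner ℝ q b = 1) (hqc : inner ℝ q c < 1)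
    (hra : inner ℝ r a = 1) (hrb : inner ℝ r b < 1) (hrc : inner ℝ r c = 1)
    (hza : 1 ≤ inner ℝ z a) (hzb : inner ℝ z b ≤ 1) (hzc : inner ℝ z c ≤ 1) :
    z ∈ convexHull ℝ {p, q, r} := by
  have hd := det_sub_ne_zero (b := b) (by rintro rfl; linarith) hpb hqb hrb.ne
  obtain ⟨s, t, hst⟩ := exists_eq_smul_add_smul hd (z - p)
  have hz' : z = p + s • (q - p) + t • (r - p) := by rw [add_assoc, ← hst]; abel
  have hin : ∀ y : Plane, inner ℝ z y = inner ℝ p y + s * (inner ℝ q y - inner ℝ p y) +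
      t * (inner ℝ r y - inner ℝ p y) := fun y => by
    rw [hz']
    simp only [inner_add_left, inner_sub_left, real_inner_smul_left]
  rw [hin, hpb, hqb] at hzb
  rw [hin, hpc, hrc] at hzc
  rw [hin, hqa, hra] at hza
  rw [hz']
  -- Each half-plane fixes the sign of one barycentric coordinate: `c` that of `q`, `b` that of `r`,
  -- `a` that of `p`.
  refine smul_add_smul_mem_convexHull ?_ ?_ ?_
  · by_contra! h
    nlinarith [mul_pos_of_neg_of_neg h (sub_neg.2 hqc)]
  · by_contra! h
    nlinarith [mul_pos_of_neg_of_neg h (sub_neg.2 hrb)]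
  · by_contra! h
    nlinarith

/-- Cutting two opposite triangular caps off a symmetric convex set. The caps are bounded by the
line dual to `a` and by the lines dual to `b` and `c`. -/
theorem volume_eq_volume_slab_add {K : Set Plane} (hconv : Convex ℝ K)
    (hneg : -K = K) {a b c p q r : Plane} (hp : p ∈ K) (hq : q ∈ K) (hr : r ∈ K)
    (hb : ∀ z ∈ K, inner ℝ z b ≤ 1) (hc : ∀ z ∈ K, inner ℝ z c ≤ 1)
    (hpa : 1 < inner ℝ p a) (hpb : inner ℝ p b = 1) (hpc : inner ℝ p c = 1)
    (hqa : inner ℝ q a = 1) (hqb : inner ℝ q b = 1) (hqc : inner ℝ q c < 1)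
    (hra : inner ℝ r a = 1) (hrb : inner ℝ r b < 1) (hrc : inner ℝ r c = 1) :
    volume K = volume (K ∩ {z | |inner ℝ z a| ≤ 1}) + ENNReal.ofReal |det (q - p) (r - p)| := by
  have ha : a ≠ 0 := by rintro rfl; simp at hqa
  have hd := det_sub_ne_zero (b := b) (by rintro rfl; linarith) hpb hqb hrb.ne
  set T := convexHull ℝ ({p, q, r} : Set Plane) with hT
  have hTm : MeasurableSet T :=
    (((Set.finite_singleton r).insert q).insert p |>.isClosed_convexHull ℝ).measurableSet
  have hTK : T ⊆ K := convexHull_min (by rintro z (rfl | rfl | rfl) <;> assumption) hconv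
  have hTa : ∀ z ∈ T, 1 ≤ inner ℝ z a := by
    have hsub : T ⊆ {z | 1 ≤ inner ℝ a z} := convexHull_min (by
      rintro z (rfl | rfl | rfl) <;> change 1 ≤ inner ℝ a _ <;> rw [real_inner_comm] <;> linarith)
      (convex_halfSpace_ge (innerSL ℝ a).toLinearMap.isLinear 1)
    intro z hz
    rw [real_inner_comm]
    exact hsub hz
  have hcap : ∀ z ∈ K, 1 ≤ inner ℝ z a → z ∈ T := fun z hz hza =>
    mem_convexHull_of_le hpa hpb hpc hqa hqb hqc hra hrb hrc hza (hb z hz) (hc z hz)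
  have hnegmem : ∀ z ∈ K, -z ∈ K := fun z hz => by rw [← hneg]; simpa using hz
  have hunion : K = (K ∩ {z | |inner ℝ z a| ≤ 1}) ∪ (T ∪ -T) := by
    ext z
    constructor
    · intro hz
      by_cases h : |inner ℝ z a| ≤ 1
      · exact Or.inl ⟨hz, h⟩
      · right
        rw [not_le, lt_abs] at h
        rcases h with h | h
        · exact Or.inl (hcap z hz h.le)
        · refine Or.inr (hcap (-z) (hnegmem z hz) ?_)
          rw [inner_neg_left]
          exact h.le
    · rintro (h | h | h)
      · exact h.1
      · exact hTK h
      · simpa using hnegmem _ (hTK h)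
  have hdisj : Disjoint T (-T) := by
    rw [Set.disjoint_left]
    intro z h1 h2
    have := hTa z h1
    have h3 := hTa (-z) h2
    rw [inner_neg_left] at h3
    linarith
  have hae : AEDisjoint volume (K ∩ {z | |inner ℝ z a| ≤ 1}) (T ∪ -T) := by
    refine measure_mono_null (t := {z | inner ℝ a z = 1} ∪ {z | inner ℝ (-a) z = 1}) ?_
      (measure_union_null (volume_dualLine ha) (volume_dualLine (neg_ne_zero.2 ha)))
    rintro z ⟨⟨-, h1⟩, h2⟩
    have h1' := abs_le.1 (show |inner ℝ z a| ≤ 1 from h1)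
    rcases h2 with h2 | h2
    · left
      change inner ℝ a z = 1
      rw [real_inner_comm]
      exact le_antisymm h1'.2 (hTa z h2)
    · right
      have := hTa (-z) h2
      rw [inner_neg_left] at this
      change inner ℝ (-a) z = 1
      rw [inner_neg_left, real_inner_comm]
      linarith [h1'.1]
  conv_lhs => rw [hunion]
  -- The two opposite triangles together contribute twice the area of one, hence the full
  -- determinant.
  rw [measure_union₀ (hTm.union hTm.neg).nullMeasurableSet hae,
    measure_union hdisj hTm.neg, Measure.measure_neg, volume_convexHull_triple hd]

/-! ### Deleting a pair of opposite vertices -/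

/-- A vertex `x` of a polygon with its two adjacent edges, dual to `w₀` and `w₁`, the other end
points `q` and `y` of these edges, and the line through `q` and `y`, dual to `w'`. -/
structure VertexCap (A : Set Plane) (x q y w₀ w₁ w' : Plane) : Prop where
  x_mem : x ∈ A.extremePoints ℝ
  q_mem : q ∈ A.extremePoints ℝ
  y_mem : y ∈ A.extremePoints ℝ
  w₀_mem : w₀ ∈ polarBody A
  w₁_mem : w₁ ∈ polarBody A
  x_w₀ : inner ℝ x w₀ = 1
  x_w₁ : inner ℝ x w₁ = 1
  q_w₀ : inner ℝ q w₀ = 1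
  y_w₁ : inner ℝ y w₁ = 1
  q_w₁ : inner ℝ q w₁ < 1
  y_w₀ : inner ℝ y w₀ < 1
  q_w' : inner ℝ q w' = 1
  y_w' : inner ℝ y w' = 1
  x_w' : 1 < inner ℝ x w'

namespace VertexCap

variable {A : Set Plane} {x q y w₀ w₁ w' : Plane} (hA : IsCentrallySymmetricPolygon A)
  (h : VertexCap A x q y w₀ w₁ w')
include hA h

omit hA in
theorem q_mem_sdiff : q ∈ A.extremePoints ℝ \ {x, -x} := by
  refine ⟨h.q_mem, ?_⟩
  rintro (rfl | rfl)
  · exact h.q_w₁.ne h.x_w₁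
  · have := h.q_w₀
    rw [inner_neg_left, h.x_w₀] at this
    norm_num at this

omit hA in
theorem y_mem_sdiff : y ∈ A.extremePoints ℝ \ {x, -x} := by
  refine ⟨h.y_mem, ?_⟩
  rintro (rfl | rfl)
  · exact h.y_w₀.ne h.x_w₀
  · have := h.y_w₁
    rw [inner_neg_left, h.x_w₁] at this
    norm_num at this

/-- A vertex beyond the line `qy` would lie in the triangle `xqy` and so be a corner; but `x` has
been removed, and `q`, `y` are on the line. -/
theorem w'_mem : w' ∈ polarBody (A.extremePoints ℝ \ {x, -x}) := by
  intro u hu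
  by_contra! hlt
  have hmem := mem_convexHull_of_le h.x_w' h.x_w₀ h.x_w₁ h.q_w' h.q_w₀ h.q_w₁ h.y_w' h.y_w₀ h.y_w₁
    hlt.le (h.w₀_mem u hu.1.1) (h.w₁_mem u hu.1.1)
  have hsub : ({x, q, y} : Set Plane) ⊆ A := by
    rintro z (rfl | rfl | rfl)
    exacts [h.x_mem.1, h.q_mem.1, h.y_mem.1]
  rcases mem_of_mem_convexHull hA.convex hsub hu.1 hmem with rfl | rfl | rfl
  · exact hu.2 (by simp)
  · exact hlt.ne' h.q_w'
  · exact hlt.ne' h.y_w'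

omit h in
theorem neg_sdiff : -(A.extremePoints ℝ \ {x, -x}) = A.extremePoints ℝ \ {x, -x} := by
  have key : ∀ z ∈ A.extremePoints ℝ \ {x, -x}, -z ∈ A.extremePoints ℝ \ {x, -x} := by
    rintro z ⟨hz, hne⟩
    refine ⟨neg_mem_extremePoints hA.neg_eq hz, fun hz' => hne ?_⟩
    rcases hz' with hz' | hz'
    · right; rw [Set.mem_singleton_iff, ← hz', neg_neg]
    · left; exact neg_injective hz'
  ext z
  exact ⟨fun hz => by simpa using key _ hz, fun hz => key _ hz⟩

omit h in
-- The slab restores exactly the constraints of the deleted `x` and `-x`.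
theorem polarBody_sdiff_inter :
    polarBody (A.extremePoints ℝ \ {x, -x}) ∩ {z | |inner ℝ z x| ≤ 1} ⊆ polarBody A := by
  rintro z ⟨hz, hzx⟩
  rw [← hA.polarBody_extremePoints]
  intro u hu
  have hzx' := abs_le.1 (show |inner ℝ z x| ≤ 1 from hzx)
  rw [real_inner_comm] at hzx'
  by_cases hux : u ∈ ({x, -x} : Set Plane)
  · rcases hux with rfl | rfl
    · exact hzx'.2
    · rw [inner_neg_left]; linarith [hzx'.1]
  · exact hz u ⟨hu, hux⟩

omit hA h in
theorem polarBody_subset_polarBody_sdiff :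
    polarBody A ⊆ polarBody (A.extremePoints ℝ \ {x, -x}) :=
  polarBody_anti (Set.sdiff_subset.trans extremePoints_subset)

omit hA in
-- The corners `w'`, `w₀`, `w₁` are the pairwise intersections of the lines dual to `q`, `y` and
-- `x`.
theorem cap_subset {z : Plane} (hz : z ∈ polarBody (A.extremePoints ℝ \ {x, -x}))
    (hzx : 1 ≤ inner ℝ z x) : z ∈ convexHull ℝ {w', w₀, w₁} := by
  apply mem_convexHull_of_le (a := x) (b := q) (c := y) <;> try rw [real_inner_comm]
  exacts [h.x_w', h.q_w', h.y_w', h.x_w₀, h.q_w₀, h.y_w₀, h.x_w₁, h.q_w₁, h.y_w₁,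
    by rwa [real_inner_comm], hz q h.q_mem_sdiff, hz y h.y_mem_sdiff]

omit h in
theorem neg_polarBody_sdiff :
    -polarBody (A.extremePoints ℝ \ {x, -x}) = polarBody (A.extremePoints ℝ \ {x, -x}) :=
  neg_polarBody (neg_sdiff hA)

/-- By the bipolar theorem, a point of `A` in the slab is tested against the polar of the remaining
vertices. An element there is in `A°` or, up to sign, in the triangle `w' w₀ w₁`, where it is enough
to check the corners. -/
theorem inter_slab :
    A ∩ {z | |inner ℝ z w'| ≤ 1} = convexHull ℝ (A.extremePoints ℝ \ {x, -x}) := by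
  apply Set.Subset.antisymm
  · rintro a ⟨ha, haw⟩
    have haw' := abs_le.1 (show |inner ℝ a w'| ≤ 1 from haw)
    have hcl := (hA.finite_extremePoints.subset
      (Set.sdiff_subset (t := {x, -x}))).isClosed_convexHull ℝ
    have hneg : -q ∈ A.extremePoints ℝ \ {x, -x} := by
      rw [← neg_sdiff hA]; simpa using h.q_mem_sdiff
    have h0 : (0 : Plane) ∈ convexHull ℝ (A.extremePoints ℝ \ {x, -x}) := by
      have := convex_convexHull ℝ (A.extremePoints ℝ \ {x, -x})
        (subset_convexHull ℝ _ h.q_mem_sdiff) (subset_convexHull ℝ _ hneg)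
        (a := 1 / 2) (b := 1 / 2) (by norm_num) (by norm_num) (by norm_num)
      simpa using this
    rw [← polarBody_polarBody (convex_convexHull ℝ _) hcl h0, polarBody_convexHull]
    have hcap : ∀ b ∈ A, inner ℝ b w' ≤ 1 → ∀ f ∈ polarBody (A.extremePoints ℝ \ {x, -x}),
        1 ≤ inner ℝ f x → inner ℝ b f ≤ 1 := by
      intro b hb hbw f hf hfx
      have hsub : convexHull ℝ {w', w₀, w₁} ⊆ {f | inner ℝ b f ≤ 1} := convexHull_min (by
        rintro f (rfl | rfl | rfl)
        exacts [hbw, h.w₀_mem b hb, h.w₁_mem b hb]) (convex_inner_le b 1)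
      exact hsub (h.cap_subset hf hfx)
    intro f hf
    rw [real_inner_comm]
    by_cases hfx : |inner ℝ f x| ≤ 1
    · exact polarBody_sdiff_inter hA ⟨hf, hfx⟩ a ha
    · rw [not_le, lt_abs] at hfx
      rcases hfx with hfx | hfx
      · exact hcap a ha haw'.2 f hf hfx.le
      · have hf' : -f ∈ polarBody (A.extremePoints ℝ \ {x, -x}) := by
          rw [← neg_polarBody_sdiff hA]; simpa using hf
        have := hcap (-a) (hA.neg_mem ha) (by rw [inner_neg_left]; linarith [haw'.1]) (-f) hf'
          (by rw [inner_neg_left]; exact hfx.le)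
        simpa using this
  · refine convexHull_min (fun u hu => ⟨hu.1.1, ?_⟩) (hA.convex.inter ?_)
    · have hu' : -u ∈ A.extremePoints ℝ \ {x, -x} := by
        rw [← neg_sdiff hA]; simpa using hu
      have h1 := h.w'_mem hA u hu
      have h2 := h.w'_mem hA _ hu'
      rw [inner_neg_left] at h2
      exact abs_le.2 ⟨by linarith, h1⟩
    · have : {z : Plane | |inner ℝ z w'| ≤ 1} =
          {z | inner ℝ w' z ≤ 1} ∩ {z | inner ℝ (-w') z ≤ 1} := by
        ext z
        simp only [Set.mem_inter_iff, Set.mem_ofPred_eq, abs_le, inner_neg_left, real_inner_comm z]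
        constructor <;> rintro ⟨h1, h2⟩ <;> constructor <;> linarith
      rw [this]
      exact (convex_inner_le _ _).inter (convex_inner_le _ _)

theorem isCentrallySymmetricPolygon :
    IsCentrallySymmetricPolygon (convexHull ℝ (A.extremePoints ℝ \ {x, -x})) := by
  refine isCentrallySymmetricPolygon_of_finite (hA.finite_extremePoints.subset Set.sdiff_subset)
    rfl ?_ (by rw [← convexHull_neg, neg_sdiff hA])
  rw [← h.inter_slab hA]
  refine inter_mem hA.mem_nhds_zero ?_
  have hc : ContinuousAt (fun z : Plane => |inner ℝ z w'|) 0 := by fun_prop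
  have : ∀ᶠ z in 𝓝 (0 : Plane), |inner ℝ z w'| < 1 :=
    hc.eventually_lt continuousAt_const (by simp)
  exact this.mono fun _ => le_of_lt

omit h in
theorem extremePoints_sdiff :
    (convexHull ℝ (A.extremePoints ℝ \ {x, -x})).extremePoints ℝ =
      A.extremePoints ℝ \ {x, -x} := by
  refine extremePoints_convexHull_subset.antisymm fun u hu => ?_
  have hsub : convexHull ℝ (A.extremePoints ℝ \ {x, -x}) ⊆ A :=
    convexHull_min (Set.sdiff_subset.trans extremePoints_subset) hA.convex
  exact inter_extremePoints_subset_extremePoints_of_subset hsub ⟨subset_convexHull ℝ _ hu, hu.1⟩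

theorem ncard_extremePoints_sdiff :
    ((convexHull ℝ (A.extremePoints ℝ \ {x, -x})).extremePoints ℝ).ncard =
      (A.extremePoints ℝ).ncard - 2 := by
  have hne : x ≠ -x := fun e => by
    have h1 := h.x_w₀
    have h2 := h.x_w₀
    rw [e, inner_neg_left] at h1
    linarith
  rw [extremePoints_sdiff hA, Set.ncard_sdiff (Set.pair_subset h.x_mem
    (neg_mem_extremePoints hA.neg_eq h.x_mem)), Set.ncard_pair hne]

theorem volume_eq : volume A = volume (convexHull ℝ (A.extremePoints ℝ \ {x, -x})) +
    ENNReal.ofReal |det (q - x) (y - x)| := by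
  rw [← h.inter_slab hA]
  exact volume_eq_volume_slab_add hA.convex hA.neg_eq h.x_mem.1 h.q_mem.1 h.y_mem.1
    (fun z hz => h.w₀_mem z hz) (fun z hz => h.w₁_mem z hz) h.x_w' h.x_w₀ h.x_w₁ h.q_w' h.q_w₀
    h.q_w₁ h.y_w' h.y_w₀ h.y_w₁

/-- Here the enlarged polar is the body being cut, along the lines dual to `±x`; what remains is
`A°`. -/
theorem volume_polarBody_eq :
    volume (polarBody (convexHull ℝ (A.extremePoints ℝ \ {x, -x}))) =
      volume (polarBody A) + ENNReal.ofReal |det (w₀ - w') (w₁ - w')| := by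
  have hslab : polarBody (A.extremePoints ℝ \ {x, -x}) ∩ {z | |inner ℝ z x| ≤ 1} =
      polarBody A := by
    refine (polarBody_sdiff_inter hA).antisymm fun z hz =>
      ⟨polarBody_subset_polarBody_sdiff hz, ?_⟩
    have h1 := hz x h.x_mem.1
    have h2 := hz (-x) (hA.neg_mem h.x_mem.1)
    rw [inner_neg_left] at h2
    change |inner ℝ z x| ≤ 1
    rw [real_inner_comm]
    exact abs_le.2 ⟨by linarith, h1⟩
  rw [polarBody_convexHull, ← hslab]
  apply volume_eq_volume_slab_add (b := q) (c := y) (convex_polarBody _)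
    (neg_polarBody_sdiff hA) (h.w'_mem hA) (polarBody_subset_polarBody_sdiff h.w₀_mem)
    (polarBody_subset_polarBody_sdiff h.w₁_mem)
    (fun z hz => by rw [real_inner_comm]; exact hz q h.q_mem_sdiff)
    (fun z hz => by rw [real_inner_comm]; exact hz y h.y_mem_sdiff) <;> rw [real_inner_comm]
  exacts [h.x_w', h.q_w', h.y_w', h.x_w₀, h.q_w₀, h.y_w₀, h.x_w₁, h.q_w₁, h.y_w₁]

end VertexCap

/-! ### Comparing the two moves -/

theorem mul_lt_or_mul_lt_of_mul_le {V U α β γ δ : ℝ} (hV : 0 ≤ V) (hα : 0 < α) (hβ : 0 < β)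
    (hγ : 0 < γ) (hδ : 0 < δ) (h : γ * β ≤ α * δ) :
    (V - α) * (U + β) < V * U ∨ (V + γ) * (U - δ) < V * U := by
  by_contra! hcon
  obtain ⟨h1, h2⟩ := hcon
  -- The weights `γ` and `α` make `U` cancel in the sum.
  have e1 := mul_le_mul_of_nonneg_left h1 hγ.le
  have e2 := mul_le_mul_of_nonneg_left h2 hα.le
  have e3 := mul_le_mul_of_nonneg_left h hV
  have e4 : 0 < α * γ * β := by positivity
  have e5 : 0 < α * γ * δ := by positivity
  nlinarith

theorem ennreal_mul_lt_or_mul_lt {V U V' U' : ENNReal} {α β γ δ : ℝ} (hVt : V ≠ ⊤) (hUt : U ≠ ⊤)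
    (hα : 0 < α) (hβ : 0 < β) (hγ : 0 < γ) (hδ : 0 < δ) (h : γ * β ≤ α * δ)
    (hV : V = V' + ENNReal.ofReal α) (hU : U = U' + ENNReal.ofReal δ) :
    V' * (U + ENNReal.ofReal β) < V * U ∨ (V + ENNReal.ofReal γ) * U' < V * U := by
  have hV't : V' ≠ ⊤ := fun e => hVt (by rw [hV, e, top_add])
  have hU't : U' ≠ ⊤ := fun e => hUt (by rw [hU, e, top_add])
  obtain ⟨v, hv, rfl⟩ : ∃ v : ℝ, 0 ≤ v ∧ V' = ENNReal.ofReal v :=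
    ⟨V'.toReal, ENNReal.toReal_nonneg, (ENNReal.ofReal_toReal hV't).symm⟩
  obtain ⟨u, hu, rfl⟩ : ∃ u : ℝ, 0 ≤ u ∧ U' = ENNReal.ofReal u :=
    ⟨U'.toReal, ENNReal.toReal_nonneg, (ENNReal.ofReal_toReal hU't).symm⟩
  rw [← ENNReal.ofReal_add hv hα.le] at hV
  rw [← ENNReal.ofReal_add hu hδ.le] at hU
  subst hV hU
  rw [← ENNReal.ofReal_add (by positivity) hβ.le, ← ENNReal.ofReal_add (by positivity) hγ.le,
    ← ENNReal.ofReal_mul hv, ← ENNReal.ofReal_mul (by positivity),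
    ← ENNReal.ofReal_mul (by positivity),
    ENNReal.ofReal_lt_ofReal_iff (by positivity), ENNReal.ofReal_lt_ofReal_iff (by positivity)]
  simpa using mul_lt_or_mul_lt_of_mul_le (V := v + α) (U := u + δ) (by positivity) hα hβ hγ hδ h

/-- Consecutive incidences `v — q — w₀ — x — w₁ — y` between vertices of a polygon and of its
polar. -/
structure IncidenceChain (A : Set Plane) (v q w₀ x w₁ y : Plane) : Prop where
  v_mem : v ∈ (polarBody A).extremePoints ℝ
  q_mem : q ∈ A.extremePoints ℝ
  w₀_mem : w₀ ∈ (polarBody A).extremePoints ℝ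
  x_mem : x ∈ A.extremePoints ℝ
  w₁_mem : w₁ ∈ (polarBody A).extremePoints ℝ
  y_mem : y ∈ A.extremePoints ℝ
  q_v : inner ℝ q v = 1
  q_w₀ : inner ℝ q w₀ = 1
  x_w₀ : inner ℝ x w₀ = 1
  x_w₁ : inner ℝ x w₁ = 1
  y_w₁ : inner ℝ y w₁ = 1
  v_ne_w₀ : v ≠ w₀
  q_ne_x : q ≠ x
  w₀_ne_w₁ : w₀ ≠ w₁
  x_ne_y : x ≠ y

/-- If `⟨q, w₁⟩ ≥ 0`, removing the vertex `x` or the edge dual to `w₀` decreases the Mahler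
volume. -/
theorem IncidenceChain.mahlerVolume_lt {A : Set Plane} (hA : IsCentrallySymmetricPolygon A)
    {v q w₀ x w₁ y : Plane} (h : IncidenceChain A v q w₀ x w₁ y) (hk : 0 ≤ inner ℝ q w₁) :
    (∃ w', VertexCap A x q y w₀ w₁ w') ∧ (∃ z, VertexCap (polarBody A) w₀ v w₁ q x z) ∧
    (mahlerVolume (convexHull ℝ (A.extremePoints ℝ \ {x, -x})) < mahlerVolume A ∨
      mahlerVolume (polarBody (convexHull ℝ ((polarBody A).extremePoints ℝ \ {w₀, -w₀}))) <
        mahlerVolume A) := by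
  -- Equality in any of these bounds would put two distinct dual lines through the same two
  -- vertices.
  have hqw₁ : inner ℝ q w₁ < 1 := lt_of_le_of_ne (h.w₁_mem.1 q h.q_mem.1) fun e =>
    h.w₀_ne_w₁ (eq_of_inner_eq_one h.q_ne_x h.q_w₀ h.x_w₀ e h.x_w₁)
  have hyw₀ : inner ℝ y w₀ < 1 := lt_of_le_of_ne (h.w₀_mem.1 y h.y_mem.1) fun e =>
    h.w₀_ne_w₁ (eq_of_inner_eq_one h.x_ne_y h.x_w₀ e h.x_w₁ h.y_w₁)
  have hxv : inner ℝ x v < 1 := lt_of_le_of_ne (h.v_mem.1 x h.x_mem.1) fun e =>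
    h.v_ne_w₀ (eq_of_inner_eq_one h.q_ne_x h.q_v e h.q_w₀ h.x_w₀)
  have hD : det q x ≠ 0 := det_ne_zero_of_inner_eq_one h.q_ne_x h.q_w₀ h.x_w₀
  set k := inner ℝ q w₁ with hkdef
  set l := inner ℝ x v with hldef
  -- In the basis `q, x`, the incidence of `y` with `w₁` fixes its second coefficient, and `⟨y, w₀⟩
  -- < 1` makes the first one negative.
  obtain ⟨c, b, hy⟩ := exists_eq_smul_add_smul hD y
  have hb : b = 1 - c * k := by
    have := h.y_w₁
    rw [hy, inner_add_left, real_inner_smul_left, real_inner_smul_left, h.x_w₁] at this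
    linarith
  obtain ⟨a, rfl⟩ : ∃ a, c = -a := ⟨-c, by simp⟩
  have ha : 0 < a := by
    rw [hy, inner_add_left, real_inner_smul_left, real_inner_smul_left, h.x_w₀, h.q_w₀] at hyw₀
    nlinarith
  have hk1 : 0 < 1 - k := by linarith
  have hl1 : 0 < 1 - l := by linarith
  have hak : 0 < 1 + a * k := by positivity
  have hkl : 0 < 1 - k * l := by nlinarith
  obtain ⟨m, hm0, hm⟩ : ∃ m : ℝ, 0 < m ∧ m * (1 - k * l) = 1 :=
    ⟨(1 - k * l)⁻¹, inv_pos.2 hkl, inv_mul_cancel₀ hkl.ne'⟩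
  -- The value at `x` is forced by `⟨y, w'⟩ = 1`.
  obtain ⟨w', hqw', hxw'⟩ := exists_inner_eq hD 1 ((1 + a) / (1 + a * k))
  have hr : (1 + a) / (1 + a * k) = 1 + a * (1 - k) / (1 + a * k) := by field_simp; ring
  rw [hr] at hxw'
  have hpos : 0 < a * (1 - k) / (1 + a * k) := by positivity
  -- The point where the lines dual to `v` and `w₁` meet, that is, the new vertex once the edge `qx`
  -- is deleted.
  set z : Plane := ((1 - l) * m) • q + ((1 - k) * m) • x with hz
  have hcap : VertexCap A x q y w₀ w₁ w' :=
    { x_mem := h.x_mem, q_mem := h.q_mem, y_mem := h.y_mem, w₀_mem := h.w₀_mem.1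
      w₁_mem := h.w₁_mem.1, x_w₀ := h.x_w₀, x_w₁ := h.x_w₁, q_w₀ := h.q_w₀, y_w₁ := h.y_w₁
      q_w₁ := hqw₁, y_w₀ := hyw₀, q_w' := hqw'
      y_w' := by
        rw [hy, inner_add_left, real_inner_smul_left, real_inner_smul_left, hqw', hxw', hb]
        field_simp
        ring
      x_w' := by rw [hxw']; linarith }
  have hA2 := hA.polarBody_polarBody
  have hcap' : VertexCap (polarBody A) w₀ v w₁ q x z :=
    { x_mem := h.w₀_mem, q_mem := h.v_mem, y_mem := h.w₁_mem
      w₀_mem := by rw [hA2]; exact h.q_mem.1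
      w₁_mem := by rw [hA2]; exact h.x_mem.1
      x_w₀ := by rw [real_inner_comm]; exact h.q_w₀
      x_w₁ := by rw [real_inner_comm]; exact h.x_w₀
      q_w₀ := by rw [real_inner_comm]; exact h.q_v
      y_w₁ := by rw [real_inner_comm]; exact h.x_w₁
      q_w₁ := by rw [real_inner_comm]; exact hxv
      y_w₀ := by rw [real_inner_comm]; exact hqw₁
      q_w' := by
        rw [real_inner_comm, hz, inner_add_left, real_inner_smul_left, real_inner_smul_left, h.q_v,
          ← hldef]
        linear_combination hm
      y_w' := by
        rw [real_inner_comm, hz, inner_add_left, real_inner_smul_left, real_inner_smul_left,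
          h.x_w₁, ← hkdef]
        linear_combination hm
      x_w' := by
        rw [real_inner_comm, hz, inner_add_left, real_inner_smul_left, real_inner_smul_left,
          h.q_w₀, h.x_w₀]
        nlinarith [mul_pos hm0 (mul_pos hl1 hk1)] }
  refine ⟨⟨w', hcap⟩, ⟨z, hcap'⟩, ?_⟩
  have hΔ : 0 < |det q x| := abs_pos.2 hD
  have hα : |det (q - x) (y - x)| = |det q x| * (a * (1 - k)) := by
    rw [← abs_of_pos (mul_pos ha hk1), ← abs_mul, ← abs_neg]
    congr 1
    rw [hy, hb]
    simp only [det, PiLp.sub_apply, PiLp.add_apply, PiLp.smul_apply, smul_eq_mul]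
    ring
  have hβ : |det (w₀ - w') (w₁ - w')| = a * (1 - k) ^ 2 / (1 + a * k) / |det q x| := by
    have hp : 0 < a * (1 - k) ^ 2 / (1 + a * k) := by positivity
    rw [eq_div_iff hΔ.ne', ← abs_of_pos hp, ← abs_mul, det_mul_det, ← abs_neg]
    congr 1
    simp only [inner_sub_right, h.q_w₀, h.x_w₀, h.x_w₁, hqw', hxw', ← hkdef]
    field_simp
    ring
  have hγ : |det (q - z) (x - z)| = |det q x| * ((1 - l) * (1 - k) * m) := by
    have hp : 0 < (1 - l) * (1 - k) * m := by positivity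
    rw [← abs_of_pos hp, ← abs_mul, ← abs_neg]
    congr 1
    rw [hz]
    simp only [det, PiLp.sub_apply, PiLp.add_apply, PiLp.smul_apply, smul_eq_mul]
    linear_combination (q 0 * x 1 - q 1 * x 0) * hm
  have hδ : |det (v - w₀) (w₁ - w₀)| = (1 - l) * (1 - k) / |det q x| := by
    have hp : 0 < (1 - l) * (1 - k) := by positivity
    rw [eq_div_iff hΔ.ne', ← abs_of_pos hp, ← abs_mul, det_mul_det, ← abs_neg]
    congr 1
    simp only [inner_sub_right, h.q_w₀, h.x_w₀, h.x_w₁, h.q_v, ← hkdef, ← hldef]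
    ring
  have hV := hcap.volume_eq hA
  have hU' := hcap.volume_polarBody_eq hA
  have hU := hcap'.volume_eq hA.polar
  have hV' := hcap'.volume_polarBody_eq hA.polar
  rw [hA2] at hV'
  have hC := (hcap'.isCentrallySymmetricPolygon hA.polar).polarBody_polarBody
  unfold mahlerVolume
  rw [hU', hV', hC]
  refine ennreal_mul_lt_or_mul_lt hA.isCompact.measure_ne_top hA.polar.isCompact.measure_ne_top
    ?_ ?_ ?_ ?_ ?_ hV hU
  · rw [hα]; positivity
  · rw [hβ]; positivity
  · rw [hγ]; positivity
  · rw [hδ]; positivity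
  · rw [hα, hβ, hγ, hδ]
    -- This is `γβ ≤ αδ` after cancellation. The sign of `k` enters twice: in `k l ≤ k` and in `1 ≤
    -- 1 + a k`.
    have hmain : (1 - k) * m ≤ 1 + a * k := by
      have h1 : (1 - k) * m ≤ (1 - k * l) * m :=
        mul_le_mul_of_nonneg_right (by nlinarith) hm0.le
      have h2 : 0 ≤ a * k := by positivity
      linarith
    have e1 : |det q x| * ((1 - l) * (1 - k) * m) *
        (a * (1 - k) ^ 2 / (1 + a * k) / |det q x|) =
        (a * (1 - k) ^ 2 * (1 - l)) * ((1 - k) * m / (1 + a * k)) := by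
      field_simp
    have e2 : |det q x| * (a * (1 - k)) * ((1 - l) * (1 - k) / |det q x|) =
        (a * (1 - k) ^ 2 * (1 - l)) * 1 := by
      field_simp
    rw [e1, e2]
    exact mul_le_mul_of_nonneg_left ((div_le_one hak).2 hmain) (by positivity)

/-! ### Finding a suitable vertex and edge -/

variable {A : Set Plane}

theorem exists_other_edge (hA : IsCentrallySymmetricPolygon A) {x : Plane}
    (hx : x ∈ A.extremePoints ℝ) (w : Plane) :
    ∃ w' ∈ (polarBody A).extremePoints ℝ, w' ≠ w ∧ inner ℝ x w' = 1 := by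
  obtain ⟨w₁, hw₁, w₂, hw₂, hne, h₁, h₂, -⟩ := hA.exists_segment hx
  by_cases h : w₁ = w
  · exact ⟨w₂, hw₂, h ▸ hne.symm, h₂⟩
  · exact ⟨w₁, hw₁, h, h₁⟩

theorem exists_other_vertex (hA : IsCentrallySymmetricPolygon A) {w : Plane}
    (hw : w ∈ (polarBody A).extremePoints ℝ) (x : Plane) :
    ∃ x' ∈ A.extremePoints ℝ, x' ≠ x ∧ inner ℝ x' w = 1 := by
  have := exists_other_edge hA.polar hw x
  rw [hA.polarBody_polarBody] at this
  simpa only [real_inner_comm] using this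

/-- A vertex is not a proper convex combination of the origin and two points of the polygon. -/
theorem eq_or_eq_of_eq_smul_add_smul (hA : IsCentrallySymmetricPolygon A) {u p q : Plane}
    (hu : u ∈ A.extremePoints ℝ) (hp : p ∈ A) (hq : q ∈ A) {s t : ℝ} (hs : 0 ≤ s) (ht : 0 ≤ t)
    (hst : s + t ≤ 1) (h : u = s • p + t • q) : u = p ∨ u = q := by
  have hmem := smul_add_smul_mem_convexHull (p := 0) (q := p) (r := q) hs ht hst
  simp only [sub_zero, zero_add, ← h] at hmem
  have hsub : ({0, p, q} : Set Plane) ⊆ A := by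
    rintro z (rfl | rfl | rfl)
    exacts [hA.zero_mem, hp, hq]
  exact (mem_of_mem_convexHull hA.convex hsub hu hmem).resolve_left (hA.ne_zero hu)

/-- If a vertex lies strictly beyond the edge `x₁x₂` on the side of `x₂`, and not below the
parallel to this edge through the origin, then so does the neighbor `x₃` of `x₂`. -/
theorem inner_nonneg_of_beyond (hA : IsCentrallySymmetricPolygon A) {x₁ x₂ x₃ w₁ w₂ u : Plane}
    (hx₁ : x₁ ∈ A.extremePoints ℝ) (hx₂ : x₂ ∈ A.extremePoints ℝ) (hx₃ : x₃ ∈ A.extremePoints ℝ)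
    (hw₂ : w₂ ∈ (polarBody A).extremePoints ℝ) (h12 : x₁ ≠ x₂) (hw : w₂ ≠ w₁)
    (h11 : inner ℝ x₁ w₁ = 1) (h21 : inner ℝ x₂ w₁ = 1) (h22 : inner ℝ x₂ w₂ = 1)
    (h32 : inner ℝ x₃ w₂ = 1) (hu : u ∈ A.extremePoints ℝ) {a b : ℝ} (hab : u = a • x₁ + b • x₂)
    (ha : a < 0) (huw : 0 ≤ inner ℝ u w₁) : 0 ≤ inner ℝ x₃ w₁ := by
  have hd : det x₁ x₂ ≠ 0 := det_ne_zero_of_inner_eq_one h12 h11 h21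
  have hh : inner ℝ x₁ w₂ < 1 := lt_of_le_of_ne (hw₂.1 x₁ hx₁.1) fun e =>
    hw (eq_of_inner_eq_one h12 e h22 h11 h21)
  -- If `x₃` were on the negative side, solving for `u` in terms of `x₂` and `x₃` would give
  -- positive coefficients of sum `⟨u, w₂⟩ ≤ 1`. Then `u` is `x₂`, against `a ≠ 0`, or `x₃`, against
  -- its sign.
  by_contra! hneg
  obtain ⟨e, f, hef⟩ := exists_eq_smul_add_smul hd x₃
  have huw₂ := hw₂.1 u hu.1
  have hneg' : e + f < 0 := by
    rw [hef, inner_add_left, real_inner_smul_left, real_inner_smul_left, h11, h21] at hneg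
    linarith
  have huw' : 0 ≤ a + b := by
    rw [hab, inner_add_left, real_inner_smul_left, real_inner_smul_left, h11, h21] at huw
    linarith
  have h32' : e * inner ℝ x₁ w₂ + f = 1 := by
    rw [hef, inner_add_left, real_inner_smul_left, real_inner_smul_left, h22] at h32
    linarith
  have he : e < 0 := by nlinarith
  have hlam : 0 < (b * e - f * a) / e := by
    apply div_pos_of_neg_of_neg _ he
    nlinarith [mul_nonneg_of_nonpos_of_nonpos ha.le hneg'.le, mul_pos_of_neg_of_neg ha hneg']
  have hmu : 0 < a / e := div_pos_of_neg_of_neg ha he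
  have hucomb : u = ((b * e - f * a) / e) • x₂ + (a / e) • x₃ := by
    have e1 : (b * e - f * a) / e = b - f * (a / e) := by
      rw [sub_div, mul_div_cancel_right₀ _ he.ne, mul_div_assoc]
    have e2 : a = a / e * e := (div_mul_cancel₀ a he.ne).symm
    rw [hab, hef, e1]
    nth_rw 1 [e2]
    module
  have hle : (b * e - f * a) / e + a / e ≤ 1 := by
    rw [hucomb, inner_add_left, real_inner_smul_left, real_inner_smul_left, h22, h32] at huw₂
    linarith
  rcases eq_or_eq_of_eq_smul_add_smul hA hu hx₂.1 hx₃.1 hlam.le hmu.le hle hucomb with h | h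
  · have : det x₂ u = a * det x₂ x₁ := by
      rw [hab]
      simp only [det, PiLp.add_apply, PiLp.smul_apply, smul_eq_mul]
      ring
    have h0 : det x₂ u = 0 := by rw [h, det]; ring
    rw [h0] at this
    have hd' : det x₂ x₁ ≠ 0 := det_ne_zero_of_inner_eq_one h12.symm h21 h11
    exact mul_ne_zero ha.ne hd' this.symm
  · rw [h] at huw
    exact hneg.not_ge huw

/-- The chain is traversed toward the given edge: `q = x₃`, `x = x₂`, `y = x₁`, so the deleted edge
is `x₂x₃`. -/
theorem exists_incidenceChain_of_beyond (hA : IsCentrallySymmetricPolygon A) {x₁ x₂ w₁ u : Plane}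
    (hx₁ : x₁ ∈ A.extremePoints ℝ) (hx₂ : x₂ ∈ A.extremePoints ℝ)
    (hw₁ : w₁ ∈ (polarBody A).extremePoints ℝ) (h12 : x₁ ≠ x₂)
    (h11 : inner ℝ x₁ w₁ = 1) (h21 : inner ℝ x₂ w₁ = 1) (hu : u ∈ A.extremePoints ℝ) {a b : ℝ}
    (hab : u = a • x₁ + b • x₂) (ha : a < 0) (huw : 0 ≤ inner ℝ u w₁) :
    ∃ v q w₀ x w₁ y, IncidenceChain A v q w₀ x w₁ y ∧ 0 ≤ inner ℝ q w₁ := by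
  obtain ⟨w₂, hw₂, hw, h22⟩ := exists_other_edge hA hx₂ w₁
  obtain ⟨x₃, hx₃, h3, h32⟩ := exists_other_vertex hA hw₂ x₂
  obtain ⟨v, hv, hvne, h3v⟩ := exists_other_edge hA hx₃ w₂
  exact ⟨v, x₃, w₂, x₂, w₁, x₁, ⟨hv, hx₃, hw₂, hx₂, hw₁, hx₁, h3v, h32, h22, h21, h11, hvne, h3,
    hw, h12.symm⟩, inner_nonneg_of_beyond hA hx₁ hx₂ hx₃ hw₂ h12 hw h11 h21 h22 h32 hu hab ha huw⟩

theorem exists_incidenceChain (hA : IsCentrallySymmetricPolygon A)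
    (hcard : 4 < (A.extremePoints ℝ).ncard) :
    ∃ v q w₀ x w₁ y, IncidenceChain A v q w₀ x w₁ y ∧ 0 ≤ inner ℝ q w₁ := by
  obtain ⟨x₁, hx₁⟩ : (A.extremePoints ℝ).Nonempty :=
    Set.nonempty_of_ncard_ne_zero (by omega)
  obtain ⟨w₁, hw₁, -, h11⟩ := exists_other_edge hA hx₁ 0
  obtain ⟨x₂, hx₂, h21', h21⟩ := exists_other_vertex hA hw₁ x₁
  have hd : det x₁ x₂ ≠ 0 := det_ne_zero_of_inner_eq_one h21'.symm h11 h21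
  obtain ⟨u, hu, hu', huw⟩ : ∃ u ∈ A.extremePoints ℝ, u ∉ ({x₁, -x₁, x₂, -x₂} : Set Plane) ∧
      0 ≤ inner ℝ u w₁ := by
    obtain ⟨u, hu, hu'⟩ : ∃ u ∈ A.extremePoints ℝ, u ∉ ({x₁, -x₁, x₂, -x₂} : Set Plane) := by
      by_contra! hall
      have h1 := Set.ncard_le_ncard (t := {x₁, -x₁, x₂, -x₂}) hall
      have h2 : ({x₁, -x₁, x₂, -x₂} : Set Plane).ncard ≤ 4 := by
        refine (Set.ncard_insert_le _ _).trans (Nat.succ_le_succ ?_)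
        refine (Set.ncard_insert_le _ _).trans (Nat.succ_le_succ ?_)
        refine (Set.ncard_insert_le _ _).trans (Nat.succ_le_succ ?_)
        simp
      omega
    rcases le_total 0 (inner ℝ u w₁) with h | h
    · exact ⟨u, hu, hu', h⟩
    · refine ⟨-u, neg_mem_extremePoints hA.neg_eq hu, ?_, by rw [inner_neg_left]; linarith⟩
      simp only [Set.mem_insert_iff, Set.mem_singleton_iff, not_or, neg_eq_iff_eq_neg,
        neg_neg] at hu' ⊢
      exact ⟨hu'.2.1, hu'.1, hu'.2.2.2, hu'.2.2.1⟩
  obtain ⟨a, b, hab⟩ := exists_eq_smul_add_smul hd u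
  rcases lt_or_ge a 0 with ha | ha
  · exact exists_incidenceChain_of_beyond hA hx₁ hx₂ hw₁ h21'.symm h11 h21 hu hab ha huw
  rcases lt_or_ge b 0 with hb | hb
  · exact exists_incidenceChain_of_beyond hA hx₂ hx₁ hw₁ h21' h21 h11 hu
      (hab.trans (add_comm _ _)) hb huw
  -- With both coefficients nonnegative, `u` would lie in the triangle `0 x₁ x₂` and so equal `x₁`
  -- or `x₂`.
  have hle := hw₁.1 u hu.1
  rw [hab, inner_add_left, real_inner_smul_left, real_inner_smul_left, h11, h21, mul_one,
    mul_one] at hle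
  rcases eq_or_eq_of_eq_smul_add_smul hA hu hx₁.1 hx₂.1 ha hb hle hab with h | h <;>
  · exact absurd (by simp [h]) hu'

end Plane

/-! ### The theorem -/

open Plane in
theorem theorem1p3 (n : ℕ) (hn : 2 < n) (A : Set Plane)
    (hA : IsCentrallySymmetricPolygon A) (hedges : (polygonEdges A).ncard = 2 * n) :
    ∃ (𝓗 : Set (Set Plane)) (𝓟 : Set Plane),
      IsHyperplanePresentation A 𝓗 ∧ IsVertexPresentation A 𝓟 ∧
      ((∃ H ∈ 𝓗, -H ∈ 𝓗 ∧
          IsCentrallySymmetricPolygon (boundedRegion (𝓗 \ {H, -H})) ∧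
          (polygonEdges (boundedRegion (𝓗 \ {H, -H}))).ncard = 2 * (n - 1) ∧
          mahlerVolume (boundedRegion (𝓗 \ {H, -H})) < mahlerVolume A) ∨
       (∃ x ∈ 𝓟, -x ∈ 𝓟 ∧
          IsCentrallySymmetricPolygon (convexHull ℝ (𝓟 \ {x, -x})) ∧
          (polygonEdges (convexHull ℝ (𝓟 \ {x, -x}))).ncard = 2 * (n - 1) ∧
          mahlerVolume (convexHull ℝ (𝓟 \ {x, -x})) < mahlerVolume A)) := by
  have hW : ((polarBody A).extremePoints ℝ).ncard = 2 * n := hA.ncard_polygonEdges.symm.trans hedges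
  have hP : (A.extremePoints ℝ).ncard = 2 * n := hA.ncard_extremePoints_polarBody.symm.trans hW
  obtain ⟨v, q, w₀, x, w₁, y, h, hk⟩ := exists_incidenceChain hA (by omega)
  obtain ⟨⟨w', hcap⟩, ⟨z, hcap'⟩, hlt⟩ := h.mahlerVolume_lt hA hk
  refine ⟨_, _, isHyperplanePresentation hA, isVertexPresentation hA, ?_⟩
  rcases hlt with hlt | hlt
  · right
    have hA' := hcap.isCentrallySymmetricPolygon hA
    refine ⟨x, h.x_mem, neg_mem_extremePoints hA.neg_eq h.x_mem, hA', ?_, hlt⟩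
    rw [hA'.ncard_polygonEdges, hA'.ncard_extremePoints_polarBody,
      hcap.ncard_extremePoints_sdiff hA, hP]
    omega
  · left
    have hC := hcap'.isCentrallySymmetricPolygon hA.polar
    have hneg := neg_mem_extremePoints hA.polar.neg_eq h.w₀_mem
    refine ⟨dualLine w₀, ⟨w₀, h.w₀_mem, rfl⟩, ⟨-w₀, hneg, (neg_dualLine w₀).symm⟩, ?_⟩
    -- The new region is the polar of the hull of the remaining vertices of `A°`, so those vertices
    -- count its edges.
    rw [boundedRegion_image_dualLine_sdiff (fun w hw => hA.polar.ne_zero hw) h.w₀_mem hneg,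
      ← polarBody_convexHull]
    refine ⟨hC.polar, ?_, hlt⟩
    rw [hC.polar.ncard_polygonEdges, hC.polarBody_polarBody,
      hcap'.ncard_extremePoints_sdiff hA.polar, hW]
    omega
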